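/- For a complex number $z$ put $\gamma_\infty(z)=\pi^{-z/2}\,\Gamma(z/2)$, for a prime $p$ put $\gamma_p(z)=(1-p^{-z})^{-1}$, and for a place $v$ of $\mathbb{Q}$ let $\rho_v(z)=\gamma_v(z)/\gamma_v(1-z)$. Let $\mathbb{C}_-=\{z\in\mathbb{C} : \operatorname{Re} z\le \tfrac12\}$, with boundary the critical line $\partial\mathbb{C}_-=\{\operatorname{Re} z=\tfrac12\}$ equipped with arc length. Let $P$ be the orthogonal projection of $L^2(\partial\mathbb{C}_-)$ onto the Hardy space $H^2(\mathbb{C}_-)$, the space of $L^2$ boundary values of the functions $G$ holomorphic on $\{\operatorname{Re} z<\tfrac12\}$ with $\sup_{x<1/2}\int_{\mathbb{R}}|G(x+is)|^2\,ds<\infty$. A function $u\in L^\infty(\partial\mathbb{C}_-)$ is called quasi-inner relative to $\mathbb{C}_-$ if $|u|=1$ almost everywhere and the operator $(1-P)uP$ on $L^2(\partial\mathbb{C}_-)$ is compact, where $u$ acts by multiplication. A bounded operator $T$ on a Hilbert space is called an infinitesimal of order $\alpha>0$ if it is compact and its characteristic values $\mu_n(T)=\inf\{\|T-R\| : \operatorname{rank}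 R\le n\}$ satisfy $\mu_n(T)=O(n^{-\alpha})$ as $n\to\infty$. **Theorem.** Let $F$ be a finite set of places of $\mathbb{Q}$ that contains the archimedean place, and let $m\ge 0$ be the number of primes in $F$, so that $F$ has $m+1$ elements. Then the restriction to the critical line of $$u=\prod_{v\in F}\rho_v=\rho_\infty\prod_{p\in F}\rho_p$$ is quasi-inner relative to $\mathbb{C}_-$. Moreover, the off-diagonal part $(1-P)uP$ is an infinitesimal of order $\frac{1}{2m}$ if $m\ge 1$, and an infinitesimal of order $\alpha$ for every $\alpha>0$ if $m=0$. -/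

import Mathlib

open MeasureTheory Filter Topology
open scoped ENNReal

noncomputable section

namespace QuasiInner

/-- The places of `ℚ`: the archimedean place, and one place for each prime number. -/
inductive Place where
  | archimedean : Place
  | prime (p : Nat.Primes) : Place

/-- The local `L`-factors `γ_v`. At the archimedean place `Complex.Gammaℝ z` is
`π ^ (-z / 2) * Γ(z / 2)`. -/
def localFactor : Place → ℂ → ℂ
  | .archimedean, z => Complex.Gammaℝ z
  | .prime p, z => (1 - ((p : ℕ) : ℂ) ^ (-z))⁻¹

/-- The ratio `ρ_v(z) = γ_v(z) / γ_v(1 - z)`. -/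
def localRatio (v : Place) (z : ℂ) : ℂ :=
  localFactor v z / localFactor v (1 - z)

/-- The product of the ratios `ρ_v` over a finite set of places. -/
def ratioProduct (F : Finset Place) (z : ℂ) : ℂ :=
  ∏ v ∈ F, localRatio v z

/-- The point `x + i s` of the vertical line `Re z = x`. -/
def linePoint (x s : ℝ) : ℂ := (x : ℂ) + (s : ℂ) * Complex.I

/-- `L²` of the critical line `Re z = 1/2` for arc length, the line being parametrized by
`s ↦ 1/2 + i s`. -/
abbrev BoundaryL2 : Type := Lp ℂ 2 (volume : Measure ℝ)

/-- `L^∞` of the critical line, in the same parametrization. -/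
abbrev BoundaryLinfty : Type := Lp ℂ ∞ (volume : Measure ℝ)

/-- `G` is a holomorphic function on the open half-plane `Re z < 1/2` whose `L²` norms on the
vertical lines are bounded, and `f` is its boundary value on the critical line. -/
structure IsHardyExtension (G : ℂ → ℂ) (f : ℝ → ℂ) : Prop where
  holomorphic : DifferentiableOn ℂ G {z : ℂ | z.re < 1 / 2}
  bounded : ∃ C : ℝ≥0∞, C < ∞ ∧
    ∀ x : ℝ, x < 1 / 2 → eLpNorm (fun s : ℝ => G (linePoint x s)) 2 volume ≤ C
  boundary : Tendsto (fun x : ℝ => eLpNorm (fun s : ℝ => G (linePoint x s) - f s) 2 volume)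
    (𝓝[<] (1 / 2)) (𝓝 0)

theorem continuous_on_line {G : ℂ → ℂ} (hG : DifferentiableOn ℂ G {z : ℂ | z.re < 1 / 2})
    {x : ℝ} (hx : x < 1 / 2) : Continuous fun s : ℝ => G (linePoint x s) := by
  refine hG.continuousOn.comp_continuous (by unfold linePoint; fun_prop) fun s => ?_
  simpa [linePoint] using hx

theorem IsHardyExtension.congr {G : ℂ → ℂ} {f g : ℝ → ℂ} (h : IsHardyExtension G f)
    (hfg : f =ᵐ[volume] g) : IsHardyExtension G g := by
  refine ⟨h.holomorphic, h.bounded, h.boundary.congr fun x => eLpNorm_congr_ae ?_⟩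
  filter_upwards [hfg] with s hs
  rw [hs]

theorem IsHardyExtension.add {G H : ℂ → ℂ} {f g : ℝ → ℂ} (hf : AEStronglyMeasurable f volume)
    (hg : AEStronglyMeasurable g volume)
    (hG : IsHardyExtension G f) (hH : IsHardyExtension H g) :
    IsHardyExtension (G + H) (f + g) := by
  obtain ⟨C, hC, hGC⟩ := hG.bounded
  obtain ⟨D, hD, hHD⟩ := hH.bounded
  refine ⟨hG.holomorphic.add hH.holomorphic, ⟨C + D, ENNReal.add_lt_top.2 ⟨hC, hD⟩, ?_⟩, ?_⟩
  · intro x hx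
    exact (eLpNorm_add_le (continuous_on_line hG.holomorphic hx).aestronglyMeasurable
      (continuous_on_line hH.holomorphic hx).aestronglyMeasurable (by norm_num)).trans
      (add_le_add (hGC x hx) (hHD x hx))
  · have hsum := hG.boundary.add hH.boundary
    rw [add_zero] at hsum
    refine tendsto_of_tendsto_of_tendsto_of_le_of_le' tendsto_const_nhds hsum
      (Eventually.of_forall fun _ => zero_le) ?_
    filter_upwards [self_mem_nhdsWithin] with x hx
    have key := eLpNorm_add_le (p := 2)
      ((continuous_on_line hG.holomorphic hx).aestronglyMeasurable (μ := volume) |>.sub hf)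
      ((continuous_on_line hH.holomorphic hx).aestronglyMeasurable (μ := volume) |>.sub hg)
      (by norm_num)
    refine le_trans (le_of_eq (congrArg (fun k : ℝ → ℂ => eLpNorm k 2 volume) ?_)) key
    funext s
    simp only [Pi.add_apply, Pi.sub_apply]
    ring

theorem IsHardyExtension.smul (c : ℂ) {G : ℂ → ℂ} {f : ℝ → ℂ} (hG : IsHardyExtension G f) :
    IsHardyExtension (c • G) (c • f) := by
  obtain ⟨C, hC, hGC⟩ := hG.bounded
  refine ⟨hG.holomorphic.const_smul c, ⟨‖c‖ₑ * C, ENNReal.mul_lt_top enorm_lt_top hC, ?_⟩, ?_⟩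
  · intro x hx
    have h1 : (fun s : ℝ => (c • G) (linePoint x s)) = c • fun s : ℝ => G (linePoint x s) := rfl
    rw [h1, eLpNorm_const_smul]
    gcongr
    exact hGC x hx
  · have h0 := ENNReal.Tendsto.const_mul (a := ‖c‖ₑ) hG.boundary (Or.inr enorm_ne_top)
    rw [mul_zero] at h0
    refine h0.congr fun x => ?_
    rw [← eLpNorm_const_smul]
    congr 1
    funext s
    simp [mul_sub]

/-- The Hardy space `H²` of the half-plane `Re z < 1/2`, as a space of boundary values in
`L²` of the critical line. -/
def hardySpace : Submodule ℂ BoundaryL2 where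
  carrier := {f | ∃ G : ℂ → ℂ, IsHardyExtension G f}
  zero_mem' := by
    refine ⟨0, IsHardyExtension.congr (f := 0) ⟨differentiableOn_const 0, ⟨0, by simp, ?_⟩, ?_⟩
      (Lp.coeFn_zero ℂ 2 volume).symm⟩
    · intro x _
      simp
    · simp
  add_mem' := by
    rintro f g ⟨G, hG⟩ ⟨H, hH⟩
    exact ⟨G + H, (hG.add (Lp.aestronglyMeasurable f) (Lp.aestronglyMeasurable g) hH).congr
      (Lp.coeFn_add f g).symm⟩
  smul_mem' := by
    rintro c f ⟨G, hG⟩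
    exact ⟨c • G, (hG.smul c).congr (Lp.coeFn_smul c f).symm⟩

/-- The orthogonal projection `P` of `L²` of the critical line onto the Hardy space. The Hardy
space is closed, so passing to its closure changes nothing; it only gives the completeness on
which the existence of the projection rests. -/
def hardyProjection : BoundaryL2 →L[ℂ] BoundaryL2 :=
  hardySpace.topologicalClosure.starProjection

/-- Multiplication by `u ∈ L^∞` as an operator on `L²`. -/
def multiplication (u : BoundaryLinfty) : BoundaryL2 →L[ℂ] BoundaryL2 :=
  (ContinuousLinearMap.mul ℂ ℂ).holderL volume ∞ 2 2 u

/-- The off-diagonal part `(1 - P) u P`. -/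
def offDiagonal (u : BoundaryLinfty) : BoundaryL2 →L[ℂ] BoundaryL2 :=
  (ContinuousLinearMap.id ℂ BoundaryL2 - hardyProjection) ∘L multiplication u ∘L hardyProjection

/-- `u ∈ L^∞` of the critical line is quasi-inner relative to the half-plane `Re z ≤ 1/2`. -/
def IsQuasiInner (u : BoundaryLinfty) : Prop :=
  (∀ᵐ s : ℝ, ‖u s‖ = 1) ∧ IsCompactOperator (offDiagonal u)

/-- The characteristic value `μ_n(T)`: the distance from `T` to the operators of rank at
most `n`. For compact `T` on a Hilbert space these are the eigenvalues of `|T|` in decreasing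
order, with `μ_0(T) = ‖T‖`. -/
def characteristicValue {H : Type*} [NormedAddCommGroup H] [InnerProductSpace ℂ H] (n : ℕ)
    (T : H →L[ℂ] H) : ℝ :=
  sInf {r : ℝ | ∃ R : H →L[ℂ] H, LinearMap.rank (R : H →ₗ[ℂ] H) ≤ (n : Cardinal) ∧ r = ‖T - R‖}

/-- An infinitesimal of order `α`: a compact operator with `μ_n(T) = O(n ^ (-α))`. -/
def IsInfinitesimalOfOrder {H : Type*} [NormedAddCommGroup H] [InnerProductSpace ℂ H] (α : ℝ)
    (T : H →L[ℂ] H) : Prop :=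
  IsCompactOperator T ∧
    (fun n : ℕ => characteristicValue n T) =O[atTop] fun n : ℕ => (n : ℝ) ^ (-α)

end QuasiInner

end

/-!
Each `ρ_p(z) = γ_p(z) γ_p(1 - z)⁻¹` has a second factor that is bounded and holomorphic on the
half-plane; multiplication by it preserves the Hardy space, so it changes `(1 - P) u P` only by a
bounded operator composed on the right, and it suffices to treat `ρ_∞ ∏ γ_p`. Expanding the `m`
geometric series up to the exponents with `p ^ n < X`, one finds that `∏ γ_p` is on the critical
line within `O(X ^ (-1/2))` of a sum of at most `X ^ m` exponentials `q ^ (-z)` with `q ≤ X ^ m`.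

The function `q ^ (-z) ρ_∞(z)` is the Mellin transform of `2 cos (2π q x)`. The integral over
`(1, ∞)` is bounded and holomorphic on the half-plane, by Phragmén–Lindelöf, hence has no
off-diagonal part. The integral over `(0, 1]` is a series of simple poles at `0, -1, -2, …`, each of
which has an off-diagonal part of rank one; the series converges factorially fast beyond a constant
multiple of `q` terms, and its poles do not depend on `q`. So operators of rank `O(X ^ m)`
approximate the off-diagonal part within `O(X ^ (-1/2))`: the characteristic values are
`O(n ^ (-1 / (2m)))`.
-/

namespace QuasiInner

/-! ### Limits in `L^p` -/

section LpLimits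

variable {α ι E : Type*} [MeasurableSpace α] {μ : Measure α} {p : ℝ≥0∞} {l : Filter ι}
  [l.IsCountablyGenerated]

theorem tendsto_eLpNorm_zero_of_dominated [NormedAddCommGroup E] (hp : p ≠ ∞)
    {F : ι → α → E} {g : α → ℝ} (hg : MemLp g p μ)
    (hF : ∀ᶠ i in l, AEStronglyMeasurable (F i) μ) (hFg : ∀ᶠ i in l, ∀ᵐ a ∂μ, ‖F i a‖ ≤ g a)
    (hlim : ∀ᵐ a ∂μ, Tendsto (fun i => F i a) l (𝓝 0)) :
    Tendsto (fun i => eLpNorm (F i) p μ) l (𝓝 0) := by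
  rcases eq_or_ne p 0 with rfl | hp0
  · simpa using tendsto_const_nhds
  have hpos : 0 < p.toReal := ENNReal.toReal_pos hp0 hp
  have hint : Tendsto (fun i => ∫⁻ a, ‖F i a‖ₑ ^ p.toReal ∂μ) l (𝓝 (∫⁻ _, 0 ∂μ)) := by
    refine tendsto_lintegral_filter_of_dominated_convergence' (fun a => ‖g a‖ₑ ^ p.toReal)
      (hF.mono fun i hi => hi.enorm.pow_const _) ?_
      ((eLpNorm_lt_top_iff_lintegral_rpow_enorm_lt_top hp0 hp).1 hg.eLpNorm_lt_top).ne ?_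
    · filter_upwards [hFg] with i hi
      filter_upwards [hi] with a ha
      gcongr
      exact enorm_le_iff_norm_le.2 (ha.trans (Real.le_norm_self _))
    · filter_upwards [hlim] with a ha
      simpa [Function.comp_def, hpos] using
        ((ENNReal.continuous_rpow_const (y := p.toReal)).tendsto _).comp ha.enorm
  have hroot := ((ENNReal.continuous_rpow_const (y := 1 / p.toReal)).tendsto _).comp hint
  rw [lintegral_zero, ENNReal.zero_rpow_of_pos (by positivity)] at hroot
  exact hroot.congr fun i => (eLpNorm_eq_lintegral_rpow_enorm_toReal hp0 hp).symm

theorem tendsto_eLpNorm_mul_sub_mul [NormedRing E] (hp1 : 1 ≤ p) (hp : p ≠ ∞)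
    {b g : ι → α → E} {b₀ f : α → E} {C : ℝ} (hf : MemLp f p μ)
    (hgm : ∀ᶠ i in l, AEStronglyMeasurable (g i) μ)
    (hg : Tendsto (fun i => eLpNorm (fun a => g i a - f a) p μ) l (𝓝 0))
    (hbm : ∀ᶠ i in l, AEStronglyMeasurable (b i) μ) (hb₀m : AEStronglyMeasurable b₀ μ)
    (hbC : ∀ᶠ i in l, ∀ a, ‖b i a‖ ≤ C) (hb₀C : ∀ a, ‖b₀ a‖ ≤ C)
    (hb : ∀ a, Tendsto (fun i => b i a) l (𝓝 (b₀ a))) :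
    Tendsto (fun i => eLpNorm (fun a => b i a * g i a - b₀ a * f a) p μ) l (𝓝 0) := by
  have hfixed : Tendsto (fun i => eLpNorm (fun a => (b i a - b₀ a) * f a) p μ) l (𝓝 0) := by
    refine tendsto_eLpNorm_zero_of_dominated hp (hf.norm.const_mul (C + C))
      (hbm.mono fun i hi => (hi.sub hb₀m).mul hf.1) (hbC.mono fun i hi => ?_) ?_
    · refine Eventually.of_forall fun a => (norm_mul_le _ _).trans ?_
      gcongr
      exact (norm_sub_le _ _).trans (add_le_add (hi a) (hb₀C a))
    · refine Eventually.of_forall fun a => ?_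
      simpa using ((hb a).sub_const (b₀ a)).mul_const (f a)
  have hbound := (ENNReal.Tendsto.const_mul hg (Or.inr ENNReal.ofReal_ne_top)
    (a := ENNReal.ofReal C)).add hfixed
  rw [mul_zero, add_zero] at hbound
  refine tendsto_of_tendsto_of_tendsto_of_le_of_le' tendsto_const_nhds hbound
    (Eventually.of_forall fun _ => zero_le) ?_
  filter_upwards [hgm, hbm, hbC] with i hgi hbi hCi
  have hsplit : (fun a => b i a * g i a - b₀ a * f a) =
      (fun a => b i a * (g i a - f a)) + fun a => (b i a - b₀ a) * f a := by
    funext a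
    simp only [Pi.add_apply]
    noncomm_ring
  rw [hsplit]
  refine (eLpNorm_add_le (hbi.mul (hgi.sub hf.1)) ((hbi.sub hb₀m).mul hf.1) hp1).trans
    (add_le_add ?_ le_rfl)
  exact eLpNorm_le_mul_eLpNorm_of_ae_le_mul (Eventually.of_forall fun a =>
    (norm_mul_le _ _).trans (mul_le_mul_of_nonneg_right (hCi a) (norm_nonneg _))) p

end LpLimits

/-! ### Bounded holomorphic functions on the half-plane -/

/-- The restriction of a function to the critical line, in the parametrization of
`BoundaryL2`. -/
noncomputable abbrev onLine (f : ℂ → ℂ) : ℝ → ℂ := fun s => f (linePoint (1 / 2) s)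

theorem re_linePoint (x s : ℝ) : (linePoint x s).re = x := by simp [linePoint]

theorem im_linePoint (x s : ℝ) : (linePoint x s).im = s := by simp [linePoint]

theorem continuous_linePoint (x : ℝ) : Continuous (linePoint x) := by
  unfold linePoint
  fun_prop

theorem continuous_linePoint_left (s : ℝ) : Continuous fun x => linePoint x s := by
  unfold linePoint
  fun_prop

theorem isOpen_re_lt_half : IsOpen {z : ℂ | z.re < 1 / 2} :=
  isOpen_lt Complex.continuous_re continuous_const

theorem memLp_top_onLine {f : ℂ → ℂ} {C : ℝ} (hf : ContinuousOn f {z | z.re = 1 / 2})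
    (hC : ∀ z : ℂ, z.re = 1 / 2 → ‖f z‖ ≤ C) : MemLp (onLine f) ∞ volume :=
  memLp_top_of_bound
    (hf.comp_continuous (continuous_linePoint _) fun s => re_linePoint _ s).aestronglyMeasurable C
    (Eventually.of_forall fun s => hC _ (re_linePoint _ s))

/-- The algebra `H^∞ ∩ C` of the closed half-plane `Re z ≤ 1/2`: bounded functions, continuous on
the closed half-plane and holomorphic in its interior. -/
structure IsBoundedHolomorphic (b : ℂ → ℂ) : Prop where
  diffContOnCl : DiffContOnCl ℂ b {z : ℂ | z.re < 1 / 2}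
  bounded : ∃ C : ℝ, ∀ z : ℂ, z.re ≤ 1 / 2 → ‖b z‖ ≤ C

namespace IsBoundedHolomorphic

variable {b c : ℂ → ℂ}

theorem const (w : ℂ) : IsBoundedHolomorphic fun _ => w :=
  ⟨diffContOnCl_const, ‖w‖, fun _ _ => le_rfl⟩

theorem add (hb : IsBoundedHolomorphic b) (hc : IsBoundedHolomorphic c) :
    IsBoundedHolomorphic fun z => b z + c z := by
  obtain ⟨B, hB⟩ := hb.bounded
  obtain ⟨C, hC⟩ := hc.bounded
  exact ⟨hb.diffContOnCl.add hc.diffContOnCl, B + C, fun z hz =>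
    (norm_add_le _ _).trans (add_le_add (hB z hz) (hC z hz))⟩

theorem mul (hb : IsBoundedHolomorphic b) (hc : IsBoundedHolomorphic c) :
    IsBoundedHolomorphic fun z => b z * c z := by
  obtain ⟨B, hB⟩ := hb.bounded
  obtain ⟨C, hC⟩ := hc.bounded
  refine ⟨hb.diffContOnCl.smul hc.diffContOnCl, B * C, fun z hz => ?_⟩
  exact (norm_mul _ _).trans_le (mul_le_mul (hB z hz) (hC z hz) (norm_nonneg _)
    ((norm_nonneg _).trans (hB z hz)))

theorem prod {ι : Type*} {s : Finset ι} {b : ι → ℂ → ℂ}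
    (hb : ∀ i ∈ s, IsBoundedHolomorphic (b i)) :
    IsBoundedHolomorphic fun z => ∏ i ∈ s, b i z := by
  classical
  induction s using Finset.induction_on with
  | empty => simpa using const 1
  | insert i s hi ih =>
    simp only [Finset.prod_insert hi]
    exact (hb i (s.mem_insert_self i)).mul (ih fun j hj => hb j (Finset.mem_insert_of_mem hj))

theorem continuousOn (hb : IsBoundedHolomorphic b) : ContinuousOn b {z : ℂ | z.re ≤ 1 / 2} := by
  simpa only [Complex.closure_setOfPred_re_lt] using hb.diffContOnCl.continuousOn

theorem memLp_top (hb : IsBoundedHolomorphic b) : MemLp (onLine b) ∞ volume := by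
  obtain ⟨C, hC⟩ := hb.bounded
  exact memLp_top_onLine (hb.continuousOn.mono fun z hz => le_of_eq hz) fun z hz => hC z hz.le

end IsBoundedHolomorphic

/-! ### Multipliers of the Hardy space -/

theorem IsHardyExtension.of_eq_mul {G H b : ℂ → ℂ} {f : ℝ → ℂ} {δ C : ℝ} {D : ℝ≥0∞}
    (hG : IsHardyExtension G f) (hf : MemLp f 2 volume)
    (hH : DifferentiableOn ℂ H {z : ℂ | z.re < 1 / 2}) (hD : D < ∞)
    (hHD : ∀ x < 1 / 2, eLpNorm (fun s => H (linePoint x s)) 2 volume ≤ D) (hδ : δ < 1 / 2)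
    (hHb : ∀ z : ℂ, z.re ∈ Set.Ioo δ (1 / 2) → H z = b z * G z)
    (hb : ContinuousOn b {z | z.re ∈ Set.Ioc δ (1 / 2)})
    (hbC : ∀ z : ℂ, z.re ∈ Set.Ioc δ (1 / 2) → ‖b z‖ ≤ C) :
    IsHardyExtension H fun s => onLine b s * f s := by
  have hbm : ∀ x ∈ Set.Ioc δ (1 / 2),
      AEStronglyMeasurable (fun s => b (linePoint x s)) volume := fun x hx =>
    (hb.comp_continuous (continuous_linePoint x) fun s => by
      simpa only [Set.mem_ofPred_eq, re_linePoint] using hx).aestronglyMeasurable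
  have hnhds : ∀ᶠ x in 𝓝[<] (1 / 2 : ℝ), x ∈ Set.Ioo δ (1 / 2) := Ioo_mem_nhdsLT hδ
  have hlim : ∀ s, Tendsto (fun x => b (linePoint x s)) (𝓝[<] (1 / 2)) (𝓝 (onLine b s)) := by
    intro s
    have hline : Tendsto (linePoint · s) (𝓝[<] (1 / 2)) (𝓝 (linePoint (1 / 2) s)) :=
      ((continuous_linePoint_left s).tendsto _).mono_left nhdsWithin_le_nhds
    refine (hb _ ?_).tendsto.comp (tendsto_nhdsWithin_iff.2 ⟨hline, ?_⟩)
    · simpa only [Set.mem_ofPred_eq, re_linePoint] using Set.right_mem_Ioc.2 hδ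
    · filter_upwards [hnhds] with x hx
      simpa only [Set.mem_ofPred_eq, re_linePoint] using Set.Ioo_subset_Ioc_self hx
  refine ⟨hH, ⟨D, hD, hHD⟩, (tendsto_eLpNorm_mul_sub_mul (C := C) (by norm_num) (by norm_num) hf
    (hnhds.mono fun x hx => (continuous_on_line hG.holomorphic hx.2).aestronglyMeasurable)
    hG.boundary (hnhds.mono fun x hx => hbm x (Set.Ioo_subset_Ioc_self hx))
    (hbm _ (Set.right_mem_Ioc.2 hδ)) (hnhds.mono fun x hx s => hbC _ ?_)
    (fun s => hbC _ ?_) hlim).congr' ?_⟩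
  · simpa only [re_linePoint] using Set.Ioo_subset_Ioc_self hx
  · simpa only [re_linePoint] using Set.right_mem_Ioc.2 hδ
  · filter_upwards [hnhds] with x hx
    refine congrArg (eLpNorm · 2 volume) (funext fun s => ?_)
    rw [hHb _ (by rwa [re_linePoint])]

theorem IsHardyExtension.mul {G b : ℂ → ℂ} {f : ℝ → ℂ} (hG : IsHardyExtension G f)
    (hf : MemLp f 2 volume) (hb : IsBoundedHolomorphic b) :
    IsHardyExtension (fun z => b z * G z) fun s => onLine b s * f s := by
  obtain ⟨C, hC⟩ := hb.bounded
  obtain ⟨D, hD, hGD⟩ := hG.bounded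
  refine hG.of_eq_mul (δ := 0) (D := ENNReal.ofReal C * D) hf
    (hb.diffContOnCl.differentiableOn.mul hG.holomorphic)
    (ENNReal.mul_lt_top ENNReal.ofReal_lt_top hD) (fun x hx => ?_) (by norm_num)
    (fun _ _ => rfl) (hb.continuousOn.mono fun z hz => hz.2) (fun z hz => hC z hz.2)
  refine (eLpNorm_le_mul_eLpNorm_of_ae_le_mul (Eventually.of_forall fun s => ?_) 2).trans
    (mul_le_mul_right (hGD x hx) _)
  rw [norm_mul]
  gcongr
  exact hC _ (by rw [re_linePoint]; exact hx.le)

theorem sub_re_le_norm_sub (z a : ℂ) : z.re - a.re ≤ ‖z - a‖ := by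
  simpa using Complex.re_le_norm (z - a)

theorem closedBall_subset_re_lt {a : ℂ} {r x : ℝ} (h : a.re + r < x) :
    Metric.closedBall a r ⊆ {z : ℂ | z.re < x} := fun z hz => by
  have := (sub_re_le_norm_sub z a).trans (mem_closedBall_iff_norm.1 hz)
  simp only [Set.mem_ofPred_eq]
  linarith

theorem dslope_eq_inv_sub_mul {G : ℂ → ℂ} {a z : ℂ} (ha : G a = 0) (hz : z ≠ a) :
    dslope G a z = (z - a)⁻¹ * G z := by
  rw [dslope_of_ne _ hz, slope_def_field, ha, sub_zero, div_eq_inv_mul]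

/-- Off the ball of radius `r` around the zero, division by `z - a` costs a factor `r⁻¹`; on the
ball, the quotient is bounded, and the ball only meets a segment of each vertical line. -/
theorem IsHardyExtension.exists_eLpNorm_dslope_le {G : ℂ → ℂ} {f : ℝ → ℂ} {a : ℂ}
    (hG : IsHardyExtension G f) (ha : a.re < 1 / 2) (hGa : G a = 0) :
    ∃ D < ∞, ∀ x < 1 / 2, eLpNorm (fun s => dslope G a (linePoint x s)) 2 volume ≤ D := by
  obtain ⟨r, hr, har⟩ : ∃ r > 0, a.re + r < 1 / 2 :=
    ⟨(1 / 2 - a.re) / 2, by linarith, by linarith⟩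
  have hd : DifferentiableOn ℂ (dslope G a) {z : ℂ | z.re < 1 / 2} :=
    (Complex.differentiableOn_dslope (isOpen_re_lt_half.mem_nhds ha)).2 hG.holomorphic
  obtain ⟨M, hM⟩ := (isCompact_closedBall a r).exists_bound_of_continuousOn
    (hd.continuousOn.mono (closedBall_subset_re_lt har))
  have hM0 : 0 ≤ M := (norm_nonneg _).trans (hM a (Metric.mem_closedBall_self hr.le))
  set χ : ℝ → ℝ := (Set.Icc (a.im - r) (a.im + r)).indicator fun _ => M with hχ
  have hχL : MemLp χ 2 volume := memLp_indicator_const 2 measurableSet_Icc M (Or.inr (by simp))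
  have hdom : ∀ z, ‖dslope G a z‖ ≤ r⁻¹ * ‖G z‖ + χ z.im := fun z => by
    rcases le_or_gt ‖z - a‖ r with hz | hz
    · have him := abs_le.1 ((Complex.abs_im_le_norm (z - a)).trans hz)
      rw [Complex.sub_im] at him
      rw [hχ, Set.indicator_of_mem (by constructor <;> linarith [him.1, him.2])]
      exact (hM z (mem_closedBall_iff_norm.2 hz)).trans (le_add_of_nonneg_left (by positivity))
    · have hne : z ≠ a := sub_ne_zero.1 (norm_pos_iff.1 (hr.trans hz))
      rw [dslope_eq_inv_sub_mul hGa hne, norm_mul, norm_inv]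
      exact (mul_le_mul_of_nonneg_right (inv_anti₀ hr hz.le) (norm_nonneg _)).trans
        (le_add_of_nonneg_right (Set.indicator_nonneg (fun _ _ => hM0) _))
  obtain ⟨D, hD, hGD⟩ := hG.bounded
  refine ⟨‖r⁻¹‖ₑ * D + eLpNorm χ 2 volume, ENNReal.add_lt_top.2
    ⟨ENNReal.mul_lt_top enorm_lt_top hD, hχL.eLpNorm_lt_top⟩, fun x hx => ?_⟩
  have hGm := (continuous_on_line hG.holomorphic hx).norm.aestronglyMeasurable (μ := volume)
  calc eLpNorm (fun s => dslope G a (linePoint x s)) 2 volume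
      ≤ eLpNorm ((r⁻¹ • fun s => ‖G (linePoint x s)‖) + χ) 2 volume :=
        eLpNorm_mono_real fun s => by simpa [im_linePoint] using hdom (linePoint x s)
    _ ≤ ‖r⁻¹‖ₑ * D + eLpNorm χ 2 volume := by
        refine (eLpNorm_add_le (hGm.const_smul r⁻¹) hχL.1 (by norm_num)).trans ?_
        rw [eLpNorm_const_smul, eLpNorm_norm]
        gcongr
        exact hGD x hx

theorem IsHardyExtension.inv_sub_mul {G : ℂ → ℂ} {f : ℝ → ℂ} {a : ℂ} (hG : IsHardyExtension G f)
    (hf : MemLp f 2 volume) (ha : a.re < 1 / 2) (hGa : G a = 0) :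
    IsHardyExtension (dslope G a) fun s => onLine (fun z => (z - a)⁻¹) s * f s := by
  obtain ⟨D, hD, hdD⟩ := hG.exists_eLpNorm_dslope_le ha hGa
  obtain ⟨δ, haδ, hδ⟩ := exists_between ha
  have hsub : ∀ z : ℂ, δ < z.re → δ - a.re ≤ ‖z - a‖ := fun z hz =>
    (sub_le_sub_right hz.le _).trans (sub_re_le_norm_sub z a)
  have hne : ∀ z : ℂ, δ < z.re → z - a ≠ 0 := fun z hz =>
    norm_pos_iff.1 ((sub_pos.2 haδ).trans_le (hsub z hz))
  refine hG.of_eq_mul (C := (δ - a.re)⁻¹) hf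
    ((Complex.differentiableOn_dslope (isOpen_re_lt_half.mem_nhds ha)).2 hG.holomorphic) hD hdD hδ
    (fun z hz => dslope_eq_inv_sub_mul hGa (sub_ne_zero.1 (hne z hz.1))) ?_ fun z hz => ?_
  · exact (continuousOn_id.sub continuousOn_const).inv₀ fun z hz => hne z hz.1
  · rw [norm_inv]
    exact inv_anti₀ (sub_pos.2 haδ) (hsub z hz.1)

/-! ### Characteristic values -/

section CharacteristicValue

variable {H : Type*} [NormedAddCommGroup H] [InnerProductSpace ℂ H] {S T R : H →L[ℂ] H}
  {m n : ℕ} {α r : ℝ}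

theorem characteristicValue_nonneg (n : ℕ) (T : H →L[ℂ] H) : 0 ≤ characteristicValue n T := by
  refine Real.sInf_nonneg ?_
  rintro _ ⟨R, _, rfl⟩
  exact norm_nonneg _

theorem characteristicValue_le_norm_sub (hR : LinearMap.rank (R : H →ₗ[ℂ] H) ≤ n) :
    characteristicValue n T ≤ ‖T - R‖ := by
  refine csInf_le ⟨0, ?_⟩ ⟨R, hR, rfl⟩
  rintro _ ⟨R, _, rfl⟩
  exact norm_nonneg _

theorem characteristicValue_le_norm (n : ℕ) (T : H →L[ℂ] H) : characteristicValue n T ≤ ‖T‖ := by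
  simpa using characteristicValue_le_norm_sub (T := T) (R := 0) (n := n) (by simp)

theorem characteristicValue_eq_zero (hT : LinearMap.rank (T : H →ₗ[ℂ] H) ≤ n) :
    characteristicValue n T = 0 :=
  le_antisymm (by simpa using characteristicValue_le_norm_sub (T := T) hT)
    (characteristicValue_nonneg n T)

theorem exists_rank_le_norm_sub_lt (h : characteristicValue n T < r) :
    ∃ R : H →L[ℂ] H, LinearMap.rank (R : H →ₗ[ℂ] H) ≤ n ∧ ‖T - R‖ < r := by
  obtain ⟨_, ⟨R, hR, rfl⟩, hr⟩ := exists_lt_of_csInf_lt (by exact ⟨_, 0, by simp, rfl⟩) h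
  exact ⟨R, hR, hr⟩

theorem characteristicValue_antitone (T : H →L[ℂ] H) :
    Antitone fun n => characteristicValue n T := fun m n hmn =>
  le_of_forall_gt fun r hr => by
    obtain ⟨R, hR, hTR⟩ := exists_rank_le_norm_sub_lt hr
    exact (characteristicValue_le_norm_sub (hR.trans (Nat.cast_le.2 hmn))).trans_lt hTR

theorem characteristicValue_add_le (m n : ℕ) (S T : H →L[ℂ] H) :
    characteristicValue (m + n) (S + T) ≤ characteristicValue m S + characteristicValue n T := by
  refine le_of_forall_pos_lt_add fun ε hε => ?_
  obtain ⟨A, hA, hSA⟩ := exists_rank_le_norm_sub_lt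
    (lt_add_of_pos_right (characteristicValue m S) (half_pos hε))
  obtain ⟨B, hB, hTB⟩ := exists_rank_le_norm_sub_lt
    (lt_add_of_pos_right (characteristicValue n T) (half_pos hε))
  have hAB : LinearMap.rank ((A + B : H →L[ℂ] H) : H →ₗ[ℂ] H) ≤ (m + n : ℕ) := by
    rw [ContinuousLinearMap.toLinearMap_add, Nat.cast_add]
    exact (LinearMap.rank_add_le _ _).trans (add_le_add hA hB)
  calc characteristicValue (m + n) (S + T)
      ≤ ‖(S - A) + (T - B)‖ := by
        rw [← add_sub_add_comm]
        exact characteristicValue_le_norm_sub hAB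
    _ ≤ ‖S - A‖ + ‖T - B‖ := norm_add_le _ _
    _ < characteristicValue m S + characteristicValue n T + ε := by linarith

theorem characteristicValue_comp_le (n : ℕ) (T S : H →L[ℂ] H) :
    characteristicValue n (T ∘L S) ≤ characteristicValue n T * ‖S‖ := by
  have hlim : Tendsto (fun r => r * ‖S‖) (𝓝[>] characteristicValue n T)
      (𝓝 (characteristicValue n T * ‖S‖)) :=
    ((continuous_mul_const _).tendsto _).mono_left nhdsWithin_le_nhds
  refine ge_of_tendsto hlim (eventually_mem_nhdsWithin.mono fun r hr => ?_)
  obtain ⟨R, hR, hTR⟩ := exists_rank_le_norm_sub_lt hr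
  have hRS : LinearMap.rank ((R ∘L S : H →L[ℂ] H) : H →ₗ[ℂ] H) ≤ n :=
    (LinearMap.rank_comp_le_left _ _).trans hR
  calc characteristicValue n (T ∘L S) ≤ ‖(T - R) ∘L S‖ := by
        rw [ContinuousLinearMap.sub_comp]
        exact characteristicValue_le_norm_sub hRS
    _ ≤ ‖T - R‖ * ‖S‖ := ContinuousLinearMap.opNorm_comp_le _ _
    _ ≤ r * ‖S‖ := by gcongr

theorem isCompactOperator_of_rank_le (hR : LinearMap.rank (R : H →ₗ[ℂ] H) ≤ n) :
    IsCompactOperator R := by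
  have hfin : FiniteDimensional ℂ (LinearMap.range (R : H →ₗ[ℂ] H)) :=
    Module.rank_lt_aleph0_iff.1 (hR.trans_lt Cardinal.natCast_lt_aleph0)
  have : ProperSpace (LinearMap.range (R : H →ₗ[ℂ] H)) := FiniteDimensional.proper ℂ _
  exact (isCompactOperator_of_locallyCompactSpace_dom
    (R.codRestrict (LinearMap.range (R : H →ₗ[ℂ] H)) fun x => ⟨x, rfl⟩)).clm_comp
    (LinearMap.range (R : H →ₗ[ℂ] H)).subtypeL

theorem isCompactOperator_of_tendsto_characteristicValue [CompleteSpace H]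
    (h : Tendsto (fun n => characteristicValue n T) atTop (𝓝 0)) : IsCompactOperator T := by
  refine isClosed_setOfPred_isCompactOperator.closure_subset
    (Metric.mem_closure_iff.2 fun ε hε => ?_)
  obtain ⟨n, hn⟩ := (h.eventually_lt_const hε).exists
  obtain ⟨R, hR, hTR⟩ := exists_rank_le_norm_sub_lt hn
  exact ⟨R, isCompactOperator_of_rank_le hR, by rwa [dist_eq_norm]⟩

theorem isInfinitesimalOfOrder_of_isBigO [CompleteSpace H] (hα : 0 < α)
    (h : (fun n : ℕ => characteristicValue n T) =O[atTop] fun n : ℕ => (n : ℝ) ^ (-α)) :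
    IsInfinitesimalOfOrder α T :=
  ⟨isCompactOperator_of_tendsto_characteristicValue
    (h.trans_tendsto ((tendsto_rpow_neg_atTop hα).comp tendsto_natCast_atTop_atTop)), h⟩

theorem IsInfinitesimalOfOrder.comp (hT : IsInfinitesimalOfOrder α T) (S : H →L[ℂ] H) :
    IsInfinitesimalOfOrder α (T ∘L S) := by
  refine ⟨hT.1.comp_clm S, (Asymptotics.IsBigO.of_bound ‖S‖ ?_).trans hT.2⟩
  refine Eventually.of_forall fun n => ?_
  rw [Real.norm_of_nonneg (characteristicValue_nonneg n _),
    Real.norm_of_nonneg (characteristicValue_nonneg n _), mul_comm]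
  exact characteristicValue_comp_le n T S

end CharacteristicValue

/-! ### Off-diagonal parts -/

theorem multiplication_toLp_coeFn {a : ℝ → ℂ} (ha : MemLp a ∞ volume) (f : BoundaryL2) :
    multiplication (ha.toLp a) f =ᵐ[volume] fun s => a s * f s := by
  filter_upwards [ContinuousLinearMap.coeFn_holder (r := 2) (ContinuousLinearMap.mul ℂ ℂ)
    (ha.toLp a) f, ha.coeFn_toLp] with s hmul ha
  rw [← ha]
  exact hmul

theorem norm_multiplication_le (u : BoundaryLinfty) : ‖multiplication u‖ ≤ ‖u‖ := by
  have hnorm : ‖(ContinuousLinearMap.mul ℂ ℂ).holderL (volume : Measure ℝ) ∞ 2 2‖ ≤ 1 :=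
    (ContinuousLinearMap.norm_holderL_le _).trans (ContinuousLinearMap.opNorm_mul_le ℂ ℂ)
  exact (ContinuousLinearMap.le_of_opNorm_le _ hnorm u).trans_eq (one_mul _)

theorem multiplication_mem_hardySpace {b : ℂ → ℂ} (hb : IsBoundedHolomorphic b) {f : BoundaryL2}
    (hf : f ∈ hardySpace) : multiplication (hb.memLp_top.toLp _) f ∈ hardySpace := by
  obtain ⟨G, hG⟩ := hf
  exact ⟨_, (hG.mul (Lp.memLp f) hb).congr (multiplication_toLp_coeFn hb.memLp_top f).symm⟩

theorem multiplication_inv_sub_mem_hardySpace {a : ℂ} (ha : a.re < 1 / 2)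
    (hL : MemLp (onLine fun z => (z - a)⁻¹) ∞ volume) {f : BoundaryL2} {G : ℂ → ℂ}
    (hG : IsHardyExtension G f) (hGa : G a = 0) : multiplication (hL.toLp _) f ∈ hardySpace :=
  ⟨_, (hG.inv_sub_mul (Lp.memLp f) ha hGa).congr (multiplication_toLp_coeFn hL f).symm⟩

theorem hardyProjection_mem (f : BoundaryL2) :
    hardyProjection f ∈ hardySpace.topologicalClosure :=
  Submodule.starProjection_apply_mem _ f

theorem hardyProjection_apply_of_mem {f : BoundaryL2} (hf : f ∈ hardySpace.topologicalClosure) :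
    hardyProjection f = f :=
  Submodule.starProjection_eq_self_iff.2 hf

theorem offDiagonal_add (u v : BoundaryLinfty) :
    offDiagonal (u + v) = offDiagonal u + offDiagonal v := by
  simp [offDiagonal, multiplication, ContinuousLinearMap.add_comp, ContinuousLinearMap.comp_add]

theorem offDiagonal_smul (c : ℂ) (u : BoundaryLinfty) :
    offDiagonal (c • u) = c • offDiagonal u := by
  simp [offDiagonal, multiplication, ContinuousLinearMap.smul_comp]

theorem norm_offDiagonal_le (u : BoundaryLinfty) : ‖offDiagonal u‖ ≤ ‖u‖ := by
  have hP : ‖hardyProjection‖ ≤ 1 := Submodule.starProjection_norm_le _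
  have hQ : ‖ContinuousLinearMap.id ℂ BoundaryL2 - hardyProjection‖ ≤ 1 := by
    have := Submodule.starProjection_norm_le (𝕜 := ℂ) hardySpace.topologicalClosureᗮ
    rwa [Submodule.starProjection_orthogonal] at this
  calc ‖offDiagonal u‖
      ≤ ‖ContinuousLinearMap.id ℂ BoundaryL2 - hardyProjection‖ *
          (‖multiplication u‖ * ‖hardyProjection‖) :=
        (ContinuousLinearMap.opNorm_comp_le _ _).trans
          (mul_le_mul_of_nonneg_left (ContinuousLinearMap.opNorm_comp_le _ _) (norm_nonneg _))
    _ ≤ 1 * (‖u‖ * 1) := by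
        gcongr
        exact norm_multiplication_le u
    _ = ‖u‖ := by ring

theorem offDiagonal_apply_eq_zero {u : BoundaryLinfty} {f : BoundaryL2} (hf : f ∈ hardySpace)
    (huf : multiplication u f ∈ hardySpace) : offDiagonal u f = 0 := by
  simp only [offDiagonal, ContinuousLinearMap.comp_apply, sub_apply,
    ContinuousLinearMap.id_apply]
  rw [hardyProjection_apply_of_mem (hardySpace.le_topologicalClosure hf),
    hardyProjection_apply_of_mem (hardySpace.le_topologicalClosure huf), sub_self]

theorem apply_hardyProjection_mem {A : BoundaryL2 →L[ℂ] BoundaryL2} {V : Submodule ℂ BoundaryL2}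
    (hV : IsClosed (V : Set BoundaryL2)) (h : ∀ f ∈ hardySpace, A f ∈ V) (f : BoundaryL2) :
    A (hardyProjection f) ∈ V := by
  have hle : hardySpace.topologicalClosure ≤ V.comap (A : BoundaryL2 →ₗ[ℂ] BoundaryL2) :=
    Submodule.topologicalClosure_minimal _ (fun f hf => h f hf) (hV.preimage A.continuous)
  exact hle (hardyProjection_mem f)

theorem offDiagonal_apply_mem {u : BoundaryLinfty} {V : Submodule ℂ BoundaryL2}
    (hV : IsClosed (V : Set BoundaryL2)) (h : ∀ f ∈ hardySpace, offDiagonal u f ∈ V)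
    (f : BoundaryL2) : offDiagonal u f ∈ V := by
  have hPP : offDiagonal u (hardyProjection f) = offDiagonal u f := by
    simp only [offDiagonal, ContinuousLinearMap.comp_apply]
    rw [hardyProjection_apply_of_mem (hardyProjection_mem f)]
  exact hPP ▸ apply_hardyProjection_mem hV h f

theorem offDiagonal_eq_zero {b : ℂ → ℂ} (hb : IsBoundedHolomorphic b) :
    offDiagonal (hb.memLp_top.toLp _) = 0 := by
  ext1 f
  exact (Submodule.mem_bot ℂ).1 (offDiagonal_apply_mem isClosed_singleton (fun f hf =>
    (Submodule.mem_bot ℂ).2 (offDiagonal_apply_eq_zero hf (multiplication_mem_hardySpace hb hf))) f)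

theorem offDiagonal_mul {f b : ℂ → ℂ} (hf : MemLp (onLine f) ∞ volume)
    (hb : IsBoundedHolomorphic b) (hfb : MemLp (onLine fun z => f z * b z) ∞ volume) :
    offDiagonal (hfb.toLp _) =
      offDiagonal (hf.toLp _) ∘L multiplication (hb.memLp_top.toLp _) ∘L hardyProjection := by
  have hmul : ∀ g, multiplication (hfb.toLp _) g =
      multiplication (hf.toLp _) (multiplication (hb.memLp_top.toLp _) g) := fun g => by
    refine Lp.ext ?_
    filter_upwards [multiplication_toLp_coeFn hfb g, multiplication_toLp_coeFn hb.memLp_top g,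
      multiplication_toLp_coeFn hf (multiplication (hb.memLp_top.toLp _) g)] with s hfb hb hf
    rw [hfb, hf, hb, mul_assoc]
  ext1 g
  have hmem := apply_hardyProjection_mem (A := multiplication (hb.memLp_top.toLp _))
    hardySpace.isClosed_topologicalClosure
    (fun f hf => hardySpace.le_topologicalClosure (multiplication_mem_hardySpace hb hf)) g
  simp only [offDiagonal, ContinuousLinearMap.comp_apply]
  rw [hmul, hardyProjection_apply_of_mem hmem]

/-! ### Symbols close to rational functions -/

theorem memLp_top_inv_sub {a : ℂ} (ha : a.re < 1 / 2) :
    MemLp (onLine fun z => (z - a)⁻¹) ∞ volume := by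
  have hle : ∀ z : ℂ, z.re = 1 / 2 → 1 / 2 - a.re ≤ ‖z - a‖ := fun z hz =>
    hz ▸ sub_re_le_norm_sub z a
  refine memLp_top_onLine (C := (1 / 2 - a.re)⁻¹) ?_ fun z hz => ?_
  · exact (continuousOn_id.sub continuousOn_const).inv₀ fun z hz =>
      norm_pos_iff.1 ((sub_pos.2 ha).trans_le (hle z hz))
  · rw [norm_inv]
    exact inv_anti₀ (sub_pos.2 ha) (hle z hz)

/-- On Hardy functions that vanish at the pole the off-diagonal part is zero, and these functions
have codimension at most one. -/
theorem rank_offDiagonal_inv_sub_le_one {a : ℂ} (ha : a.re < 1 / 2)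
    (hL : MemLp (onLine fun z => (z - a)⁻¹) ∞ volume) :
    LinearMap.rank (offDiagonal (hL.toLp _) : BoundaryL2 →ₗ[ℂ] BoundaryL2) ≤ 1 := by
  have hzero : ∀ f : BoundaryL2, ∀ G, IsHardyExtension G f → G a = 0 →
      offDiagonal (hL.toLp _) f = 0 := fun f G hG hGa =>
    offDiagonal_apply_eq_zero ⟨G, hG⟩ (multiplication_inv_sub_mem_hardySpace ha hL hG hGa)
  obtain ⟨v, hv⟩ : ∃ v : BoundaryL2, ∀ f ∈ hardySpace, offDiagonal (hL.toLp _) f ∈ ℂ ∙ v := by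
    by_cases! hall : ∀ (f : BoundaryL2) (G : ℂ → ℂ), IsHardyExtension G f → G a = 0
    · refine ⟨0, fun f hf => ?_⟩
      obtain ⟨G, hG⟩ := hf
      rw [hzero f G hG (hall f G hG)]
      exact Submodule.zero_mem _
    · obtain ⟨e, E, hE, hEa⟩ := hall
      refine ⟨offDiagonal (hL.toLp _) e, fun f hf => ?_⟩
      obtain ⟨G, hG⟩ := hf
      have hcomb : IsHardyExtension (G + (-(G a / E a)) • E)
          (f + (-(G a / E a)) • e : BoundaryL2) := by
        refine (hG.add (Lp.aestronglyMeasurable f) ((Lp.aestronglyMeasurable e).const_smul _)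
          (hE.smul _)).congr ?_
        filter_upwards [Lp.coeFn_add f ((-(G a / E a)) • e), Lp.coeFn_smul (-(G a / E a)) e]
          with s hadd hsmul
        rw [hadd, Pi.add_apply, Pi.add_apply, hsmul]
      have hvanish := hzero _ _ hcomb (by
        simp only [Pi.add_apply, Pi.smul_apply, smul_eq_mul, neg_mul, div_mul_cancel₀ _ hEa,
          add_neg_cancel])
      rw [map_add, map_smul] at hvanish
      rw [eq_neg_of_add_eq_zero_left hvanish]
      exact Submodule.neg_mem _ (Submodule.smul_mem _ _ (Submodule.mem_span_singleton_self _))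
  have hrange :
      LinearMap.range (offDiagonal (hL.toLp _) : BoundaryL2 →ₗ[ℂ] BoundaryL2) ≤ ℂ ∙ v := by
    rintro _ ⟨f, rfl⟩
    exact offDiagonal_apply_mem (Submodule.closed_of_finiteDimensional _) hv f
  exact (Submodule.rank_mono hrange).trans ((rank_span_le _).trans (by simp))

theorem characteristicValue_one_offDiagonal_smul_inv_sub {a : ℂ} (ha : a.re < 1 / 2) (c : ℂ) :
    characteristicValue 1 (offDiagonal (c • (memLp_top_inv_sub ha).toLp _)) = 0 := by
  refine characteristicValue_eq_zero ((Submodule.rank_mono ?_).trans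
    ((rank_offDiagonal_inv_sub_le_one ha (memLp_top_inv_sub ha)).trans (by simp)))
  rintro _ ⟨f, rfl⟩
  exact ⟨c • f, by simp [offDiagonal_smul]⟩

theorem norm_toLp_top_le {a : ℝ → ℂ} (ha : MemLp a ∞ volume) {ε : ℝ} (h : ∀ s, ‖a s‖ ≤ ε) :
    ‖ha.toLp a‖ ≤ ε := by
  rw [Lp.norm_toLp]
  refine ENNReal.toReal_le_of_le_ofReal ((norm_nonneg _).trans (h 0)) ?_
  rw [eLpNorm_exponent_top]
  exact eLpNormEssSup_le_of_ae_bound (Eventually.of_forall h)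

theorem characteristicValue_offDiagonal_le {ι : Type*} {s : Finset ι} {a c : ι → ℂ} {b : ℂ → ℂ}
    {ε : ℝ} (ha : ∀ i ∈ s, (a i).re < 1 / 2) (hb : IsBoundedHolomorphic b) {f : ℂ → ℂ}
    (hf : MemLp (onLine f) ∞ volume)
    (h : ∀ z : ℂ, z.re = 1 / 2 → ‖f z - ∑ i ∈ s, c i * (z - a i)⁻¹ - b z‖ ≤ ε) :
    characteristicValue s.card (offDiagonal (hf.toLp _)) ≤ ε := by
  classical
  induction s using Finset.induction_on generalizing f with
  | empty =>
    have hsub : offDiagonal (hf.toLp _) = offDiagonal ((hf.sub hb.memLp_top).toLp _) := by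
      rw [← add_zero (offDiagonal ((hf.sub hb.memLp_top).toLp _)), ← offDiagonal_eq_zero hb,
        ← offDiagonal_add, MemLp.toLp_sub hf hb.memLp_top, sub_add_cancel]
    rw [hsub]
    refine (characteristicValue_le_norm _ _).trans ((norm_offDiagonal_le _).trans
      (norm_toLp_top_le _ fun s => ?_))
    simpa only [Finset.sum_empty, sub_zero, Pi.sub_apply] using h _ (re_linePoint _ s)
  | insert i s hi ih =>
    have hpole := memLp_top_inv_sub (ha i (s.mem_insert_self i))
    have hg : MemLp (onLine fun z => f z - c i * (z - a i)⁻¹) ∞ volume :=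
      hf.sub (hpole.const_smul (c i))
    have hsplit : hf.toLp _ = c i • hpole.toLp _ + hg.toLp _ := by
      rw [← MemLp.toLp_const_smul, ← MemLp.toLp_add]
      exact MemLp.toLp_congr _ _ (Eventually.of_forall fun s => (add_sub_cancel _ _).symm)
    rw [Finset.card_insert_of_notMem hi, add_comm, hsplit, offDiagonal_add]
    refine (characteristicValue_add_le _ _ _ _).trans ?_
    rw [characteristicValue_one_offDiagonal_smul_inv_sub (ha i (s.mem_insert_self i)), zero_add]
    refine ih (fun j hj => ha j (Finset.mem_insert_of_mem hj)) hg fun z hz => ?_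
    have := h z hz
    rwa [Finset.sum_insert hi, ← sub_sub (f z)] at this

/-! ### Mellin transforms of exponentials -/

theorem norm_cexp_neg_mul_ofReal (a : ℂ) (x : ℝ) :
    ‖Complex.exp (-(a * x))‖ = Real.exp (-(a.re * x)) := by
  simp [Complex.norm_exp]

theorem norm_cpow_mul_exp (a z : ℂ) {x : ℝ} (hx : 0 < x) :
    ‖(x : ℂ) ^ z * Complex.exp (-(a * x))‖ = x ^ z.re * Real.exp (-(a.re * x)) := by
  rw [norm_mul, Complex.norm_cpow_eq_rpow_re_of_pos hx, norm_cexp_neg_mul_ofReal]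

theorem norm_cpow_mul_exp_le {a : ℂ} (ha : 0 ≤ a.re) (z : ℂ) {x : ℝ} (hx : 0 < x) :
    ‖(x : ℂ) ^ z * Complex.exp (-(a * x))‖ ≤ x ^ z.re := by
  rw [norm_cpow_mul_exp a z hx]
  exact mul_le_of_le_one_right (Real.rpow_nonneg hx.le _)
    (Real.exp_le_one_iff.2 (neg_nonpos.2 (mul_nonneg ha hx.le)))

theorem continuousOn_ofReal_cpow (z : ℂ) :
    ContinuousOn (fun x : ℝ => (x : ℂ) ^ z) (Set.Ioi 0) := fun x hx =>
  (Complex.continuousAt_ofReal_cpow_const x z (Or.inr (ne_of_gt hx))).continuousWithinAt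

theorem aestronglyMeasurable_cpow_mul_exp (z a : ℂ) {S : Set ℝ} (hS : MeasurableSet S)
    (hS0 : S ⊆ Set.Ioi 0) :
    AEStronglyMeasurable (fun x : ℝ => (x : ℂ) ^ z * Complex.exp (-(a * x)))
      (volume.restrict S) :=
  (((continuousOn_ofReal_cpow z).mono hS0).mul (by fun_prop)).aestronglyMeasurable hS

theorem Ioi_one_subset_Ioi_zero : Set.Ioi (1 : ℝ) ⊆ Set.Ioi 0 := Set.Ioi_subset_Ioi zero_le_one

theorem integrableOn_rpow_Ioc {z : ℂ} (hz : 0 < z.re) :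
    IntegrableOn (fun x : ℝ => x ^ (z - 1).re) (Set.Ioc 0 1) :=
  (intervalIntegrable_iff_integrableOn_Ioc_of_le zero_le_one).1
    (intervalIntegral.intervalIntegrable_rpow' (by simpa using hz))

theorem integrableOn_rpow_Ioi_one {z : ℂ} (hz : z.re < 1) :
    IntegrableOn (fun x : ℝ => x ^ (z - 2).re) (Set.Ioi 1) :=
  integrableOn_Ioi_rpow_of_lt (by simp; linarith) one_pos

theorem integrableOn_cpow_mul_exp {a z : ℂ} (ha : 0 < a.re) (hz : 0 < z.re) :
    IntegrableOn (fun x : ℝ => (x : ℂ) ^ (z - 1) * Complex.exp (-(a * x))) (Set.Ioi 0) := by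
  refine (integrableOn_rpow_mul_exp_neg_mul_rpow (s := z.re - 1) (p := 1) (by linarith)
    one_pos ha).mono' (aestronglyMeasurable_cpow_mul_exp _ _ measurableSet_Ioi subset_rfl) ?_
  filter_upwards [ae_restrict_mem measurableSet_Ioi] with x hx
  rw [norm_cpow_mul_exp _ _ hx]
  simp

theorem integrableOn_cpow_mul_exp_Ioi_one {a z : ℂ} (ha : 0 ≤ a.re) (hz : z.re < 1) :
    IntegrableOn (fun x : ℝ => (x : ℂ) ^ (z - 2) * Complex.exp (-(a * x))) (Set.Ioi 1) := by
  refine (integrableOn_rpow_Ioi_one hz).mono'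
    (aestronglyMeasurable_cpow_mul_exp _ _ measurableSet_Ioi Ioi_one_subset_Ioi_zero) ?_
  filter_upwards [ae_restrict_mem measurableSet_Ioi] with x hx
  exact norm_cpow_mul_exp_le ha _ (Ioi_one_subset_Ioi_zero hx)

theorem integrableOn_cpow_mul_exp_Ioc (a : ℂ) {z : ℂ} (hz : 0 < z.re) :
    IntegrableOn (fun x : ℝ => (x : ℂ) ^ (z - 1) * Complex.exp (-(a * x))) (Set.Ioc 0 1) := by
  refine ((integrableOn_rpow_Ioc hz).mul_const (Real.exp |a.re|)).mono'
    (aestronglyMeasurable_cpow_mul_exp _ _ measurableSet_Ioc Set.Ioc_subset_Ioi_self) ?_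
  filter_upwards [ae_restrict_mem measurableSet_Ioc] with x hx
  rw [norm_cpow_mul_exp _ _ hx.1]
  refine mul_le_mul_of_nonneg_left (Real.exp_le_exp.2 ?_) (Real.rpow_nonneg hx.1.le _)
  calc -(a.re * x) ≤ |a.re| * x := by
        rw [← neg_mul]
        exact mul_le_mul_of_nonneg_right (neg_le_abs _) hx.1.le
    _ ≤ |a.re| := mul_le_of_le_one_right (abs_nonneg _) hx.2

theorem norm_cpow_mul_exp_mul_neg_le {a w : ℂ} (z : ℂ) (hw : w ∈ Metric.ball a (a.re / 2)) {x : ℝ}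
    (hx : 0 < x) :
    ‖(x : ℂ) ^ (z - 1) * (Complex.exp (-(w * x)) * -(x : ℂ))‖ ≤
      x ^ z.re * Real.exp (-(a.re / 2) * x) := by
  have hre : a.re / 2 ≤ w.re := by
    have := (Complex.re_le_norm (a - w)).trans_lt (mem_ball_iff_norm'.1 hw)
    rw [Complex.sub_re] at this
    linarith
  have hpow : x ^ (z - 1).re * x = x ^ z.re := by
    rw [← Real.rpow_add_one hx.ne', Complex.sub_re, Complex.one_re, sub_add_cancel]
  rw [← mul_assoc, norm_mul, norm_cpow_mul_exp _ _ hx, norm_neg, Complex.norm_of_nonneg hx.le,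
    mul_right_comm, hpow, neg_mul]
  gcongr

theorem differentiableAt_integral_cpow_mul_exp {a z : ℂ} (ha : 0 < a.re) (hz : 0 < z.re) :
    DifferentiableAt ℂ
      (fun a : ℂ => ∫ x : ℝ in Set.Ioi 0, (x : ℂ) ^ (z - 1) * Complex.exp (-(a * x))) a := by
  have hderiv (x : ℝ) (w : ℂ) :
      HasDerivAt (fun w : ℂ => (x : ℂ) ^ (z - 1) * Complex.exp (-(w * x)))
      ((x : ℂ) ^ (z - 1) * (Complex.exp (-(w * x)) * -(x : ℂ))) w :=
    ((hasDerivAt_mul_const (x : ℂ)).neg.cexp).const_mul _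
  have hbound : IntegrableOn (fun x : ℝ => x ^ z.re * Real.exp (-(a.re / 2) * x ^ (1 : ℝ)))
      (Set.Ioi 0) :=
    integrableOn_rpow_mul_exp_neg_mul_rpow (by linarith) one_pos (by linarith)
  simp only [Real.rpow_one] at hbound
  refine (hasDerivAt_integral_of_dominated_loc_of_deriv_le
    (F := fun (a : ℂ) (x : ℝ) => (x : ℂ) ^ (z - 1) * Complex.exp (-(a * x)))
    (Metric.ball_mem_nhds a (half_pos ha))
    (Eventually.of_forall fun a =>
      aestronglyMeasurable_cpow_mul_exp _ _ measurableSet_Ioi subset_rfl)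
    (integrableOn_cpow_mul_exp ha hz) ?_ ?_ hbound
    (Eventually.of_forall fun x w _ => hderiv x w)).2.differentiableAt
  · exact ((continuousOn_ofReal_cpow _).mul (by fun_prop)).aestronglyMeasurable measurableSet_Ioi
  · filter_upwards [ae_restrict_mem measurableSet_Ioi] with x hx w hw
    exact norm_cpow_mul_exp_mul_neg_le z hw hx

theorem integral_cpow_mul_exp_eq_Gamma {a z : ℂ} (ha : 0 < a.re) (hz : 0 < z.re) :
    ∫ x : ℝ in Set.Ioi 0, (x : ℂ) ^ (z - 1) * Complex.exp (-(a * x)) =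
      Complex.Gamma z * a ^ (-z) := by
  have hopen : IsOpen {a : ℂ | 0 < a.re} := isOpen_lt continuous_const Complex.continuous_re
  have hreal : ∀ r : ℝ, 0 < r →
      ∫ x : ℝ in Set.Ioi 0, (x : ℂ) ^ (z - 1) * Complex.exp (-(r * x)) =
        Complex.Gamma z * (r : ℂ) ^ (-z) := fun r hr => by
    rw [Complex.integral_cpow_mul_exp_neg_mul_Ioi hz hr, mul_comm, one_div, Complex.cpow_neg,
      Complex.inv_cpow]
    rw [Complex.arg_ofReal_of_nonneg hr.le]
    exact Real.pi_pos.ne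
  have hreals : Tendsto (fun r : ℝ => (r : ℂ)) (𝓝[≠] 1) (𝓝[≠] 1) := by
    refine (Complex.continuous_ofReal.tendsto' 1 1 Complex.ofReal_one).inf
      (tendsto_principal_principal.2 fun r hr => ?_)
    simpa using hr
  refine AnalyticOnNhd.eqOn_of_preconnected_of_frequently_eq
    (f := fun a : ℂ => ∫ x : ℝ in Set.Ioi 0, (x : ℂ) ^ (z - 1) * Complex.exp (-(a * x)))
    (g := fun a : ℂ => Complex.Gamma z * a ^ (-z)) (z₀ := 1)
    (DifferentiableOn.analyticOnNhd (fun a ha =>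
      (differentiableAt_integral_cpow_mul_exp ha hz).differentiableWithinAt) hopen)
    (DifferentiableOn.analyticOnNhd (fun a ha => ?_) hopen)
    (convex_halfSpace_re_gt 0).isPreconnected
    (show (0 : ℝ) < (1 : ℂ).re by simp) ?_ ha
  · exact ((differentiableAt_id.cpow_const (Or.inl ha)).const_mul _).differentiableWithinAt
  · refine hreals.frequently (Eventually.frequently ?_)
    filter_upwards [nhdsWithin_le_nhds (Ioi_mem_nhds zero_lt_one)] with r hr
    exact hreal r hr

/-- The part of `Γ(z) a^{-z}` that comes from `(1, ∞)`, namely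
`∫_1^∞ x ^ (z - 1) * exp (-a x) dx` after one integration by parts. This form converges
absolutely for `Re z < 1` as soon as `0 ≤ Re a` and `a ≠ 0`. -/
noncomputable def upperMellin (a z : ℂ) : ℂ :=
  Complex.exp (-a) / a +
    (z - 1) / a * ∫ x : ℝ in Set.Ioi 1, (x : ℂ) ^ (z - 2) * Complex.exp (-(a * x))

theorem hasDerivAt_neg_cexp_div {a : ℂ} (ha : a ≠ 0) (x : ℝ) :
    HasDerivAt (fun x : ℝ => -(Complex.exp (-(a * x)) / a)) (Complex.exp (-(a * x))) x := by
  have h : HasDerivAt (fun x : ℝ => a * (x : ℂ)) a x := by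
    simpa using (Complex.ofRealCLM.hasDerivAt (x := x)).const_mul a
  convert! (h.fun_neg.cexp.div_const a).neg using 1
  field_simp

theorem tendsto_cpow_mul_exp_atTop {a : ℂ} (ha : 0 < a.re) (z : ℂ) :
    Tendsto (fun x : ℝ => (x : ℂ) ^ z * Complex.exp (-(a * x))) atTop (𝓝 0) := by
  refine tendsto_zero_iff_norm_tendsto_zero.2
    ((tendsto_rpow_mul_exp_neg_mul_atTop_nhds_zero z.re a.re ha).congr' ?_)
  filter_upwards [eventually_gt_atTop 0] with x hx
  rw [norm_cpow_mul_exp _ _ hx, neg_mul]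

theorem integral_Ioi_one_eq_upperMellin {a z : ℂ} (ha : 0 < a.re) (hz : 0 < z.re)
    (hz1 : z.re < 1) :
    ∫ x : ℝ in Set.Ioi 1, (x : ℂ) ^ (z - 1) * Complex.exp (-(a * x)) = upperMellin a z := by
  have ha0 : a ≠ 0 := by rintro rfl; simp at ha
  have hz0 : z - 1 ≠ 0 := sub_ne_zero.2 fun h => by simp [h] at hz1
  have hpow : ∀ x ∈ Set.Ioi (1 : ℝ), HasDerivAt (fun x : ℝ => (x : ℂ) ^ (z - 1))
      ((z - 1) * (x : ℂ) ^ (z - 2)) x := fun x hx => by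
    simpa only [sub_sub, one_add_one_eq_two] using
      hasDerivAt_ofReal_cpow_const (Ioi_one_subset_Ioi_zero hx).ne' hz0
  have hderiv : ∀ x : ℝ, (z - 1) * (x : ℂ) ^ (z - 2) * -(Complex.exp (-(a * x)) / a) =
      -((z - 1) / a) * ((x : ℂ) ^ (z - 2) * Complex.exp (-(a * x))) := fun x => by ring
  have hone : Tendsto ((fun x : ℝ => (x : ℂ) ^ (z - 1)) *
      fun x : ℝ => -(Complex.exp (-(a * x)) / a)) (𝓝[>] 1) (𝓝 (-(Complex.exp (-a) / a))) := by
    have hc := (Complex.continuousAt_ofReal_cpow_const 1 (z - 1) (Or.inr one_ne_zero)).mul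
      (hasDerivAt_neg_cexp_div ha0 1).continuousAt
    simpa using hc.tendsto.mono_left (nhdsWithin_le_nhds (s := Set.Ioi 1))
  have hinfty : Tendsto ((fun x : ℝ => (x : ℂ) ^ (z - 1)) *
      fun x : ℝ => -(Complex.exp (-(a * x)) / a)) atTop (𝓝 0) := by
    refine (mul_zero (-a⁻¹) ▸ (tendsto_cpow_mul_exp_atTop ha (z - 1)).const_mul (-a⁻¹)).congr
      fun x => ?_
    rw [Pi.mul_apply]
    ring
  rw [integral_Ioi_mul_deriv_eq_deriv_mul hpow (fun x _ => hasDerivAt_neg_cexp_div ha0 x)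
    ((integrableOn_cpow_mul_exp ha hz).mono_set Ioi_one_subset_Ioi_zero)
    (IntegrableOn.congr_fun
      ((integrableOn_cpow_mul_exp_Ioi_one ha.le hz1).const_mul (-((z - 1) / a)))
      (fun x _ => (hderiv x).symm) measurableSet_Ioi) hone hinfty, upperMellin]
  simp_rw [hderiv]
  rw [integral_const_mul]
  ring

theorem Gamma_mul_cpow_eq_of_re_pos {a z : ℂ} (ha : 0 < a.re) (hz : 0 < z.re) (hz1 : z.re < 1) :
    Complex.Gamma z * a ^ (-z) =
      (∫ x : ℝ in Set.Ioc 0 1, (x : ℂ) ^ (z - 1) * Complex.exp (-(a * x))) + upperMellin a z := by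
  rw [← integral_cpow_mul_exp_eq_Gamma ha hz, ← integral_Ioi_one_eq_upperMellin ha hz hz1,
    ← Set.Ioc_union_Ioi_eq_Ioi (zero_le_one' ℝ)]
  exact setIntegral_union (Set.Ioc_disjoint_Ioi le_rfl) measurableSet_Ioi
    (integrableOn_cpow_mul_exp_Ioc a hz)
    ((integrableOn_cpow_mul_exp ha hz).mono_set Ioi_one_subset_Ioi_zero)

theorem tendsto_integral_cpow_mul_exp {a z : ℂ} (ha : 0 ≤ a.re) {S : Set ℝ}
    (hS : MeasurableSet S) (hS0 : S ⊆ Set.Ioi 0)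
    (hint : IntegrableOn (fun x : ℝ => x ^ z.re) S) :
    Tendsto (fun ε : ℝ => ∫ x : ℝ in S, (x : ℂ) ^ z * Complex.exp (-((a + ε) * x)))
      (𝓝[>] 0) (𝓝 (∫ x : ℝ in S, (x : ℂ) ^ z * Complex.exp (-(a * x)))) := by
  refine tendsto_integral_filter_of_dominated_convergence (fun x => x ^ z.re)
    (Eventually.of_forall fun ε => aestronglyMeasurable_cpow_mul_exp _ _ hS hS0) ?_ hint ?_
  · filter_upwards [self_mem_nhdsWithin] with ε hε
    filter_upwards [ae_restrict_mem hS] with x hx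
    refine norm_cpow_mul_exp_le ?_ _ (hS0 hx)
    simpa using add_nonneg ha (le_of_lt hε)
  · refine Eventually.of_forall fun x => Tendsto.mono_left ?_ nhdsWithin_le_nhds
    exact Continuous.tendsto' (by fun_prop) _ _ (by simp)

-- On the imaginary axis the integral over `(0, ∞)` no longer converges absolutely, so the
-- identity is carried there by continuity in `a`.
theorem Gamma_mul_cpow_eq {a z : ℂ} (ha : 0 ≤ a.re) (ha0 : a ≠ 0) (hz : 0 < z.re)
    (hz1 : z.re < 1) :
    Complex.Gamma z * a ^ (-z) =
      (∫ x : ℝ in Set.Ioc 0 1, (x : ℂ) ^ (z - 1) * Complex.exp (-(a * x))) + upperMellin a z := by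
  have hbase : Tendsto (fun ε : ℝ => a + ε) (𝓝[>] 0) (𝓝 a) :=
    Tendsto.mono_left (Continuous.tendsto' (by fun_prop) _ _ (by simp)) nhdsWithin_le_nhds
  have hslit : a ∈ Complex.slitPlane := ha.lt_or_eq.imp id fun h him =>
    ha0 (Complex.ext h.symm him)
  have hleft : Tendsto (fun ε : ℝ => Complex.Gamma z * (a + ε) ^ (-z)) (𝓝[>] 0)
      (𝓝 (Complex.Gamma z * a ^ (-z))) :=
    ((continuousAt_cpow_const hslit).tendsto.comp hbase).const_mul _
  have hupper : Tendsto (fun ε : ℝ => upperMellin (a + ε) z) (𝓝[>] 0) (𝓝 (upperMellin a z)) :=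
    (((Complex.continuous_exp.tendsto _).comp hbase.neg).div hbase ha0).add
      ((tendsto_const_nhds.div hbase ha0).mul
        (tendsto_integral_cpow_mul_exp ha measurableSet_Ioi Ioi_one_subset_Ioi_zero
          (integrableOn_rpow_Ioi_one hz1)))
  refine tendsto_nhds_unique_of_eventuallyEq hleft
    ((tendsto_integral_cpow_mul_exp ha measurableSet_Ioc Set.Ioc_subset_Ioi_self
      (integrableOn_rpow_Ioc hz)).add hupper) ?_
  filter_upwards [self_mem_nhdsWithin] with ε hε
  exact Gamma_mul_cpow_eq_of_re_pos (by simpa using add_pos_of_nonneg_of_pos ha hε) hz hz1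

theorem integral_rpow_Ioi_one {z : ℂ} (hz : z.re < 1) :
    ∫ x : ℝ in Set.Ioi 1, x ^ (z - 2).re = (1 - z.re)⁻¹ := by
  rw [integral_Ioi_rpow_of_lt (by simp; linarith) one_pos, Real.one_rpow, neg_div, one_div,
    ← inv_neg, Complex.sub_re, Complex.re_ofNat]
  congr 1
  ring

theorem norm_upperMellin_le {a z : ℂ} (ha : 0 ≤ a.re) (hz : z.re < 1) :
    ‖upperMellin a z‖ ≤ ‖a‖⁻¹ * (1 + ‖z - 1‖ / (1 - z.re)) := by
  have hint : ‖∫ x : ℝ in Set.Ioi 1, (x : ℂ) ^ (z - 2) * Complex.exp (-(a * x))‖ ≤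
      (1 - z.re)⁻¹ := by
    rw [← integral_rpow_Ioi_one hz]
    refine norm_integral_le_of_norm_le (integrableOn_rpow_Ioi_one hz) ?_
    filter_upwards [ae_restrict_mem measurableSet_Ioi] with x hx
    exact norm_cpow_mul_exp_le ha _ (Ioi_one_subset_Ioi_zero hx)
  have hexp : ‖Complex.exp (-a)‖ ≤ 1 := by
    rw [Complex.norm_exp, Real.exp_le_one_iff]
    simpa using ha
  calc ‖upperMellin a z‖ ≤ ‖Complex.exp (-a) / a‖ + ‖(z - 1) / a‖ *
        ‖∫ x : ℝ in Set.Ioi 1, (x : ℂ) ^ (z - 2) * Complex.exp (-(a * x))‖ :=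
        (norm_add_le _ _).trans_eq (by rw [norm_mul])
    _ ≤ 1 / ‖a‖ + ‖z - 1‖ / ‖a‖ * (1 - z.re)⁻¹ := by
        rw [norm_div, norm_div]
        gcongr
    _ = ‖a‖⁻¹ * (1 + ‖z - 1‖ / (1 - z.re)) := by ring

theorem integral_Ioi_one_eq_mellin (f : ℝ → ℂ) (z : ℂ) :
    ∫ x : ℝ in Set.Ioi 1, (x : ℂ) ^ (z - 1) * f x = mellin ((Set.Ioi 1).indicator f) z := by
  simp_rw [mellin, ← Set.indicator_smul_apply (Set.Ioi (1 : ℝ)) fun x : ℝ => (x : ℂ) ^ (z - 1)]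
  rw [setIntegral_indicator measurableSet_Ioi, Set.inter_eq_right.2 Ioi_one_subset_Ioi_zero]
  rfl

theorem differentiableAt_mellin_indicator_Ioi_one {f : ℝ → ℂ} (hf : Continuous f) {C : ℝ}
    (hC : ∀ x, 1 < x → ‖f x‖ ≤ C) {z : ℂ} (hz : z.re < 0) :
    DifferentiableAt ℂ (mellin ((Set.Ioi 1).indicator f)) z := by
  refine mellin_differentiableAt_of_isBigO_rpow (a := 0) (b := z.re - 1)
    ((hf.locallyIntegrable.indicator measurableSet_Ioi).locallyIntegrableOn _) ?_ hz ?_ (by simp)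
  · refine Asymptotics.IsBigO.of_bound C ?_
    filter_upwards [eventually_gt_atTop 1] with x hx
    rw [Set.indicator_of_mem (Set.mem_Ioi.2 hx)]
    simpa using hC x hx
  · refine Asymptotics.IsBigO.of_bound 1 ?_
    filter_upwards [nhdsWithin_le_nhds (Iio_mem_nhds zero_lt_one)] with x hx
    rw [Set.indicator_of_notMem (by simpa using (le_of_lt hx)), norm_zero]
    positivity

theorem differentiableOn_upperMellin {a : ℂ} (ha : 0 ≤ a.re) :
    DifferentiableOn ℂ (upperMellin a) {z : ℂ | z.re < 1} := by
  have hint (z : ℂ) : ∫ x : ℝ in Set.Ioi 1, (x : ℂ) ^ (z - 2) * Complex.exp (-(a * x)) =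
      mellin ((Set.Ioi 1).indicator fun x : ℝ => Complex.exp (-(a * x))) (z - 1) := by
    rw [← integral_Ioi_one_eq_mellin, sub_sub, one_add_one_eq_two]
  intro z hz
  have hmellin : DifferentiableAt ℂ (fun z : ℂ =>
      mellin ((Set.Ioi 1).indicator fun x : ℝ => Complex.exp (-(a * x))) (z - 1)) z := by
    refine DifferentiableAt.comp (f := fun z : ℂ => z - 1) z
      (differentiableAt_mellin_indicator_Ioi_one (C := 1) (by fun_prop) (fun x hx => ?_)
        (by simpa using hz)) (by fun_prop)
    simpa using norm_cpow_mul_exp_le ha 0 (zero_lt_one.trans hx)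
  refine DifferentiableAt.differentiableWithinAt ?_
  unfold upperMellin
  simp_rw [hint]
  fun_prop

theorem integral_rpow_Ioc {z : ℂ} (hz : 0 < z.re) :
    ∫ x : ℝ in Set.Ioc 0 1, x ^ (z - 1).re = z.re⁻¹ := by
  rw [← intervalIntegral.integral_of_le zero_le_one,
    integral_rpow (Or.inl (by simpa using hz)), Complex.sub_re, Complex.one_re, sub_add_cancel,
    Real.one_rpow, Real.zero_rpow hz.ne', sub_zero, one_div]

theorem norm_integral_Ioc_cpow_mul_le {z : ℂ} (hz : 0 < z.re) {g : ℝ → ℂ} {D : ℝ}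
    (hg : ∀ x ∈ Set.Ioc (0 : ℝ) 1, ‖g x‖ ≤ D) :
    ‖∫ x : ℝ in Set.Ioc 0 1, (x : ℂ) ^ (z - 1) * g x‖ ≤ z.re⁻¹ * D := by
  rw [← integral_rpow_Ioc hz, ← integral_mul_const]
  refine norm_integral_le_of_norm_le ((integrableOn_rpow_Ioc hz).mul_const D) ?_
  filter_upwards [ae_restrict_mem measurableSet_Ioc] with x hx
  rw [norm_mul, Complex.norm_cpow_eq_rpow_re_of_pos hx.1]
  exact mul_le_mul_of_nonneg_left (hg x hx) (Real.rpow_nonneg hx.1.le _)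

theorem integrableOn_cpow_Ioc {z : ℂ} (hz : 0 < z.re) :
    IntegrableOn (fun x : ℝ => (x : ℂ) ^ (z - 1)) (Set.Ioc 0 1) := by
  simpa using integrableOn_cpow_mul_exp_Ioc 0 hz

theorem integral_cpow_Ioc {z : ℂ} (hz : 0 < z.re) :
    ∫ x : ℝ in Set.Ioc 0 1, (x : ℂ) ^ (z - 1) = z⁻¹ := by
  have hz0 : z ≠ 0 := by rintro rfl; simp at hz
  rw [← intervalIntegral.integral_of_le zero_le_one,
    integral_cpow (Or.inl (by simpa using hz))]
  simp [Complex.zero_cpow hz0]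

theorem cpow_mul_pow_div_factorial {x : ℝ} (hx : x ≠ 0) (a z : ℂ) (n : ℕ) :
    (x : ℂ) ^ (z - 1) * ((-(a * x)) ^ n / n.factorial) =
      (-a) ^ n / n.factorial * (x : ℂ) ^ (z + n - 1) := by
  rw [add_sub_right_comm, Complex.cpow_add _ _ (Complex.ofReal_ne_zero.2 hx),
    Complex.cpow_natCast, ← neg_mul, mul_pow]
  ring

theorem integrableOn_and_integral_Ioc_cpow_mul_exp_partial_sum (a : ℂ) {z : ℂ} (hz : 0 < z.re)
    (k : ℕ) :
    IntegrableOn (fun x : ℝ => (x : ℂ) ^ (z - 1) *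
      ∑ n ∈ Finset.range k, (-(a * x)) ^ n / n.factorial) (Set.Ioc 0 1) ∧
    ∫ x : ℝ in Set.Ioc 0 1, (x : ℂ) ^ (z - 1) *
        ∑ n ∈ Finset.range k, (-(a * x)) ^ n / n.factorial =
      ∑ n ∈ Finset.range k, (-a) ^ n / n.factorial * (z - -n)⁻¹ := by
  have hre (n : ℕ) : 0 < (z + n).re := by
    simpa using add_pos_of_pos_of_nonneg hz n.cast_nonneg
  have hterms : Set.EqOn (fun x : ℝ => ∑ n ∈ Finset.range k,
      (-a) ^ n / n.factorial * (x : ℂ) ^ (z + n - 1)) (fun x : ℝ => (x : ℂ) ^ (z - 1) *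
      ∑ n ∈ Finset.range k, (-(a * x)) ^ n / n.factorial) (Set.Ioc 0 1) := fun x hx => by
    simp only [Finset.mul_sum, cpow_mul_pow_div_factorial hx.1.ne']
  have hint (n : ℕ) := (integrableOn_cpow_Ioc (hre n)).const_mul ((-a) ^ n / n.factorial)
  refine ⟨IntegrableOn.congr_fun (integrable_finsetSum _ fun n _ => hint n) hterms
    measurableSet_Ioc, ?_⟩
  rw [← setIntegral_congr_fun measurableSet_Ioc hterms, integral_finsetSum _ fun n _ => hint n]
  simp_rw [integral_const_mul, integral_cpow_Ioc (hre _), sub_neg_eq_add]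

theorem norm_integral_Ioc_cpow_mul_exp_sub_sum_le {a z : ℂ} (hz : 0 < z.re) {k : ℕ}
    (hk : ‖a‖ / k.succ ≤ 1 / 2) :
    ‖(∫ x : ℝ in Set.Ioc 0 1, (x : ℂ) ^ (z - 1) * Complex.exp (-(a * x))) -
      ∑ n ∈ Finset.range k, (-a) ^ n / n.factorial * (z - -n)⁻¹‖ ≤
      z.re⁻¹ * (‖a‖ ^ k / k.factorial * 2) := by
  obtain ⟨hint, hsum⟩ := integrableOn_and_integral_Ioc_cpow_mul_exp_partial_sum a hz k
  rw [← hsum, ← integral_sub (integrableOn_cpow_mul_exp_Ioc a hz) hint]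
  simp_rw [← mul_sub]
  refine norm_integral_Ioc_cpow_mul_le hz fun x hx => ?_
  have hle : ‖-(a * (x : ℂ))‖ ≤ ‖a‖ := by
    rw [norm_neg, norm_mul, Complex.norm_of_nonneg hx.1.le]
    exact mul_le_of_le_one_right (norm_nonneg _) hx.2
  refine (Complex.exp_bound' (le_trans (by gcongr) hk)).trans ?_
  gcongr

theorem norm_Gamma_mul_cpow_sub_sum_sub_upperMellin_le {a z : ℂ} (ha : 0 ≤ a.re) (ha0 : a ≠ 0)
    (hz : 0 < z.re) (hz1 : z.re < 1) {k : ℕ} (hk : ‖a‖ / k.succ ≤ 1 / 2) :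
    ‖Complex.Gamma z * a ^ (-z) - ∑ n ∈ Finset.range k, (-a) ^ n / n.factorial * (z - -n)⁻¹ -
      upperMellin a z‖ ≤ z.re⁻¹ * (‖a‖ ^ k / k.factorial * 2) := by
  rw [Gamma_mul_cpow_eq ha ha0 hz hz1, add_sub_right_comm, add_sub_cancel_right]
  exact norm_integral_Ioc_cpow_mul_exp_sub_sum_le hz hk

theorem norm_Gamma_mul_cpow_sub_upperMellin_le {a z : ℂ} (ha : 0 ≤ a.re) (ha0 : a ≠ 0)
    (hz : 0 < z.re) (hz1 : z.re < 1) :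
    ‖Complex.Gamma z * a ^ (-z) - upperMellin a z‖ ≤ z.re⁻¹ := by
  rw [Gamma_mul_cpow_eq ha ha0 hz hz1, add_sub_cancel_right, ← mul_one z.re⁻¹]
  refine norm_integral_Ioc_cpow_mul_le hz fun x hx => ?_
  simpa using norm_cpow_mul_exp_le ha 0 hx.1

/-! ### Local factors on the critical line -/

theorem norm_natCast_cpow_neg_lt_one {n : ℕ} (hn : 1 < n) {z : ℂ} (hz : 0 < z.re) :
    ‖(n : ℂ) ^ (-z)‖ < 1 := by
  rw [Complex.norm_natCast_cpow_of_pos (by omega), Complex.neg_re]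
  exact Real.rpow_lt_one_of_one_lt_of_neg (by exact_mod_cast hn) (neg_lt_zero.2 hz)

theorem localFactor_ne_zero (v : Place) {z : ℂ} (hz : 0 < z.re) : localFactor v z ≠ 0 := by
  cases v with
  | archimedean => exact Complex.Gammaℝ_ne_zero_of_re_pos hz
  | prime p =>
    refine inv_ne_zero (sub_ne_zero.2 fun h => ?_)
    have hlt := norm_natCast_cpow_neg_lt_one p.2.one_lt hz
    rw [← h, norm_one] at hlt
    exact lt_irrefl _ hlt

theorem ofReal_cpow_conj {x : ℝ} (hx : 0 ≤ x) (z : ℂ) :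
    (x : ℂ) ^ (starRingEnd ℂ) z = (starRingEnd ℂ) ((x : ℂ) ^ z) := by
  rw [Complex.cpow_conj _ _ (by rw [Complex.arg_ofReal_of_nonneg hx]; exact Real.pi_pos.ne),
    Complex.conj_ofReal]

theorem localFactor_conj (v : Place) (z : ℂ) :
    localFactor v ((starRingEnd ℂ) z) = (starRingEnd ℂ) (localFactor v z) := by
  cases v with
  | archimedean =>
    have hhalf (w : ℂ) : (starRingEnd ℂ) w / 2 = (starRingEnd ℂ) (w / 2) := by
      rw [map_div₀, map_ofNat]
    rw [localFactor, localFactor, Complex.Gammaℝ_def, Complex.Gammaℝ_def, ← map_neg, hhalf, hhalf,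
      Complex.Gamma_conj, ofReal_cpow_conj Real.pi_pos.le, map_mul]
  | prime p =>
    have h := ofReal_cpow_conj (Nat.cast_nonneg (p : ℕ)) (-z)
    rw [Complex.ofReal_natCast] at h
    rw [localFactor, localFactor, ← map_neg, h, map_inv₀, map_sub, map_one]

theorem norm_localRatio (v : Place) {z : ℂ} (hz : z.re = 1 / 2) : ‖localRatio v z‖ = 1 := by
  have hconj : 1 - z = (starRingEnd ℂ) z := by
    apply Complex.ext
    · simp [hz]; norm_num
    · simp
  rw [localRatio, hconj, localFactor_conj, norm_div, RCLike.norm_conj]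
  exact div_self (norm_ne_zero_iff.2 (localFactor_ne_zero v (by rw [hz]; norm_num)))

theorem differentiable_inv_localFactor (v : Place) :
    Differentiable ℂ fun z => (localFactor v z)⁻¹ := by
  cases v with
  | archimedean => exact Complex.differentiable_Gammaℝ_inv
  | prime p =>
    simp only [localFactor, inv_inv]
    exact (differentiable_const 1).sub
      (differentiable_neg.const_cpow (Or.inl (Nat.cast_ne_zero.2 p.2.ne_zero)))

theorem continuousOn_localFactor (v : Place) :
    ContinuousOn (localFactor v) {z : ℂ | z.re = 1 / 2} := by
  refine ((differentiable_inv_localFactor v).continuous.continuousOn.inv₀ fun z hz =>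
    inv_ne_zero (localFactor_ne_zero v ?_)).congr fun z _ => (inv_inv (localFactor v z)).symm
  rw [show z.re = 1 / 2 from hz]
  norm_num

theorem continuousOn_localRatio (v : Place) :
    ContinuousOn (localRatio v) {z : ℂ | z.re = 1 / 2} :=
  (continuousOn_localFactor v).mul ((differentiable_inv_localFactor v).continuous.comp
    (continuous_const.sub continuous_id)).continuousOn

/-! ### The archimedean factor -/

theorem ofReal_mul_cpow {r : ℝ} (hr : 0 < r) {w : ℂ} (hw : w ≠ 0) (z : ℂ) :
    ((r : ℂ) * w) ^ z = (r : ℂ) ^ z * w ^ z := by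
  have hr0 : (r : ℂ) ≠ 0 := Complex.ofReal_ne_zero.2 hr.ne'
  rw [Complex.cpow_def_of_ne_zero (mul_ne_zero hr0 hw), Complex.log_ofReal_mul hr hw,
    Complex.cpow_def_of_ne_zero hr0, Complex.cpow_def_of_ne_zero hw, ← Complex.exp_add,
    Complex.ofReal_log hr.le, add_mul]

theorem I_cpow_add_neg_I_cpow (z : ℂ) :
    Complex.I ^ (-z) + (-Complex.I) ^ (-z) = 2 * Complex.cos (Real.pi * z / 2) := by
  rw [Complex.cpow_def_of_ne_zero Complex.I_ne_zero,
    Complex.cpow_def_of_ne_zero (neg_ne_zero.2 Complex.I_ne_zero), Complex.log_I,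
    Complex.log_neg_I, Complex.cos]
  ring_nf

theorem localRatio_archimedean {z : ℂ} (hz : 0 < z.re) :
    localRatio .archimedean z =
      2 * (2 * Real.pi) ^ (-z) * Complex.Gamma z * Complex.cos (Real.pi * z / 2) := by
  rw [← Complex.Gammaℂ_def]
  refine Complex.Gammaℝ_div_Gammaℝ_one_sub fun n h => ?_
  have hre : (2 * (n : ℂ)).re = 2 * n := by simp
  rw [h, Complex.neg_re, Complex.add_re, Complex.one_re, hre] at hz
  linarith [n.cast_nonneg (α := ℝ)]

/-- The frequency `2πt i`, whose exponential is the character `exp (-2πt i x)` that occurs in the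
Mellin representation of `t ^ (-z) * ρ_∞(z)`. -/
noncomputable def frequency (t : ℝ) : ℂ := ((2 * Real.pi * t : ℝ) : ℂ) * Complex.I

theorem re_frequency (t : ℝ) : (frequency t).re = 0 := by
  simp [frequency]

theorem frequency_neg (t : ℝ) : frequency (-t) = ((2 * Real.pi * t : ℝ) : ℂ) * -Complex.I := by
  simp [frequency]

theorem norm_frequency (t : ℝ) : ‖frequency t‖ = 2 * Real.pi * |t| := by
  simp [frequency, abs_of_pos Real.pi_pos]

theorem frequency_ne_zero {t : ℝ} (ht : t ≠ 0) : frequency t ≠ 0 := by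
  rw [← norm_ne_zero_iff, norm_frequency]
  have := Real.pi_pos
  positivity

theorem cpow_neg_mul_localRatio_archimedean {t : ℝ} (ht : 0 < t) {z : ℂ} (hz : 0 < z.re) :
    (t : ℂ) ^ (-z) * localRatio .archimedean z =
      Complex.Gamma z * frequency t ^ (-z) + Complex.Gamma z * frequency (-t) ^ (-z) := by
  have hpow : ((2 * Real.pi * t : ℝ) : ℂ) ^ (-z) = (2 * Real.pi) ^ (-z) * (t : ℂ) ^ (-z) := by
    simpa using ofReal_mul_cpow Real.two_pi_pos (Complex.ofReal_ne_zero.2 ht.ne') (-z)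
  have hpos : 0 < 2 * Real.pi * t := mul_pos Real.two_pi_pos ht
  rw [localRatio_archimedean hz, frequency_neg, frequency, ofReal_mul_cpow hpos Complex.I_ne_zero,
    ofReal_mul_cpow hpos (neg_ne_zero.2 Complex.I_ne_zero), hpow, ← mul_add, ← mul_add,
    I_cpow_add_neg_I_cpow]
  ring

/-- The holomorphic part of `t ^ (-z) * ρ_∞(z)`: what remains of this function once the poles
at `0, -1, -2, …` are removed through the part of its Mellin integral over `(0, 1]`. -/
noncomputable def holomorphicPart (t : ℝ) (z : ℂ) : ℂ :=
  upperMellin (frequency t) z + upperMellin (frequency (-t)) z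

theorem differentiableOn_holomorphicPart (t : ℝ) :
    DifferentiableOn ℂ (holomorphicPart t) {z : ℂ | z.re < 1} :=
  (differentiableOn_upperMellin (re_frequency _).ge).add
    (differentiableOn_upperMellin (re_frequency _).ge)

theorem norm_holomorphicPart_le (t : ℝ) {z : ℂ} (hz : z.re < 1) :
    ‖holomorphicPart t z‖ ≤ 2 * (2 * Real.pi * |t|)⁻¹ * (1 + ‖z - 1‖ / (1 - z.re)) := by
  have hpos := norm_upperMellin_le (re_frequency t).ge hz
  have hneg := norm_upperMellin_le (re_frequency (-t)).ge hz
  rw [norm_frequency] at hpos hneg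
  rw [abs_neg] at hneg
  exact (norm_add_le_of_le hpos hneg).trans_eq (by ring)

theorem norm_cpow_neg_mul_localRatio_archimedean_sub_le {t : ℝ} (ht : 0 < t) {k : ℕ}
    (hk : 2 * Real.pi * t / k.succ ≤ 1 / 2) {z : ℂ} (hz : z.re = 1 / 2) :
    ‖(t : ℂ) ^ (-z) * localRatio .archimedean z -
      ∑ n ∈ Finset.range k, ((-frequency t) ^ n / n.factorial +
        (-frequency (-t)) ^ n / n.factorial) * (z - -n)⁻¹ - holomorphicPart t z‖ ≤
      8 * ((2 * Real.pi * t) ^ k / k.factorial) := by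
  have hz0 : 0 < z.re := by rw [hz]; norm_num
  have hz1 : z.re < 1 := by rw [hz]; norm_num
  have hpart (r : ℝ) (hr : |r| = t) :
      ‖Complex.Gamma z * frequency r ^ (-z) -
        ∑ n ∈ Finset.range k, (-frequency r) ^ n / n.factorial * (z - -n)⁻¹ -
        upperMellin (frequency r) z‖ ≤ 4 * ((2 * Real.pi * t) ^ k / k.factorial) := by
    have hnorm : ‖frequency r‖ = 2 * Real.pi * t := by rw [norm_frequency, hr]
    have hr0 : r ≠ 0 := abs_pos.1 (hr ▸ ht)
    refine (norm_Gamma_mul_cpow_sub_sum_sub_upperMellin_le (re_frequency r).ge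
      (frequency_ne_zero hr0) hz0 hz1 (by rwa [hnorm])).trans_eq ?_
    rw [hnorm, hz]
    ring
  have hsum := norm_add_le_of_le (hpart t (abs_of_pos ht)) (hpart (-t) (by simp [abs_of_pos ht]))
  refine (le_of_eq (congrArg norm ?_)).trans (hsum.trans_eq (by ring))
  rw [cpow_neg_mul_localRatio_archimedean ht hz0, holomorphicPart]
  simp only [add_mul, Finset.sum_add_distrib]
  ring

theorem exists_norm_holomorphicPart_le_of_re_eq {t : ℝ} (ht : 0 < t) :
    ∃ C, ∀ z : ℂ, z.re = 1 / 2 → ‖holomorphicPart t z‖ ≤ C := by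
  refine ⟨t ^ (-(1 / 2) : ℝ) + (2 + 2), fun z hz => ?_⟩
  have hz0 : 0 < z.re := by rw [hz]; norm_num
  have hpart (r : ℝ) (hr : r ≠ 0) :
      ‖Complex.Gamma z * frequency r ^ (-z) - upperMellin (frequency r) z‖ ≤ 2 := by
    refine (norm_Gamma_mul_cpow_sub_upperMellin_le (re_frequency r).ge (frequency_ne_zero hr) hz0
      (by rw [hz]; norm_num)).trans_eq ?_
    rw [hz]
    norm_num
  have hratio : ‖(t : ℂ) ^ (-z) * localRatio .archimedean z‖ ≤ t ^ (-(1 / 2) : ℝ) := by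
    rw [norm_mul, norm_localRatio _ hz, mul_one, Complex.norm_cpow_eq_rpow_re_of_pos ht,
      Complex.neg_re, hz]
  have hsum := norm_add_le_of_le (hpart t ht.ne') (hpart (-t) (neg_ne_zero.2 ht.ne'))
  refine (le_of_eq (congrArg norm ?_)).trans (norm_sub_le_of_le hratio hsum)
  rw [cpow_neg_mul_localRatio_archimedean ht hz0, holomorphicPart]
  ring

theorem IsBoundedHolomorphic.of_norm_le_linear {f : ℂ → ℂ} {A B C : ℝ}
    (hf : DiffContOnCl ℂ f {z : ℂ | z.re < 1 / 2})
    (hgrowth : ∀ z : ℂ, z.re ≤ 1 / 2 → ‖f z‖ ≤ A * (1 + ‖z‖))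
    (hreal : ∀ x : ℝ, x ≤ 1 / 2 → ‖f x‖ ≤ B)
    (hline : ∀ z : ℂ, z.re = 1 / 2 → ‖f z‖ ≤ C) : IsBoundedHolomorphic f := by
  refine ⟨hf, C, fun z hz => ?_⟩
  have hre (w : ℂ) : (1 / 2 - w).re = 1 / 2 - w.re := by simp
  have hA : 0 ≤ A := by simpa using (norm_nonneg _).trans (hgrowth 0 (by simp))
  have hcont : DiffContOnCl ℂ (fun w => f (1 / 2 - w)) {w : ℂ | 0 < w.re} :=
    hf.comp (differentiable_id.const_sub (1 / 2)).diffContOnCl fun w hw => by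
      simpa only [Set.mem_ofPred_eq, hre, id, sub_lt_self_iff] using hw
  have hexp : (fun w => f (1 / 2 - w)) =O[Bornology.cobounded ℂ ⊓ 𝓟 {w : ℂ | 0 < w.re}]
      fun w => Real.exp (1 * ‖w‖ ^ (1 : ℝ)) := by
    refine Asymptotics.IsBigO.of_bound (A * 2) ?_
    filter_upwards [mem_inf_of_right (mem_principal_self _)] with w hw
    have : 0 < w.re := hw
    have htriangle : ‖1 / 2 - w‖ ≤ 1 / 2 + ‖w‖ := (norm_sub_le _ _).trans_eq (by norm_num)
    rw [Real.rpow_one, one_mul, Real.norm_of_nonneg (Real.exp_pos _).le]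
    refine (hgrowth _ (by rw [hre]; linarith)).trans ((mul_le_mul_of_nonneg_left ?_ hA).trans_eq
      (mul_assoc _ _ _).symm)
    linarith [Real.add_one_le_exp ‖w‖, norm_nonneg w]
  have hbdd : IsBoundedUnder (· ≤ ·) atTop fun x : ℝ => ‖f (1 / 2 - x)‖ := by
    refine ⟨B, eventually_map.2 ?_⟩
    filter_upwards [eventually_ge_atTop 0] with x hx
    simpa using hreal (1 / 2 - x) (by linarith)
  simpa using PhragmenLindelof.right_half_plane_of_bounded_on_real (z := 1 / 2 - z) hcont
    ⟨1, one_lt_two, 1, hexp⟩ hbdd (fun x => hline _ (by simp)) (by rw [hre]; linarith)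

theorem isBoundedHolomorphic_holomorphicPart {t : ℝ} (ht : 0 < t) :
    IsBoundedHolomorphic (holomorphicPart t) := by
  obtain ⟨C, hC⟩ := exists_norm_holomorphicPart_le_of_re_eq ht
  set A : ℝ := 2 * (2 * Real.pi * |t|)⁻¹
  have : 0 ≤ A := by have := Real.pi_pos; positivity
  have hdiff : DifferentiableOn ℂ (holomorphicPart t) (closure {z : ℂ | z.re < 1 / 2}) := by
    rw [Complex.closure_setOfPred_re_lt]
    exact (differentiableOn_holomorphicPart t).mono fun z (hz : z.re ≤ 1 / 2) =>
      hz.trans_lt one_half_lt_one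
  refine .of_norm_le_linear (A := A * 3) (B := A * 2) hdiff.diffContOnCl (fun z hz => ?_)
    (fun x hx => ?_) hC
  · refine (norm_holomorphicPart_le t (by linarith)).trans ?_
    rw [mul_assoc A]
    gcongr
    have htriangle : ‖z - 1‖ ≤ ‖z‖ + 1 := by simpa using norm_sub_le z 1
    have hquotient : ‖z - 1‖ / (1 - z.re) ≤ 2 * (‖z‖ + 1) := by
      rw [div_le_iff₀ (by linarith)]
      nlinarith [norm_nonneg z]
    linarith [norm_nonneg z]
  · have hnorm : ‖(x : ℂ) - 1‖ = 1 - x := by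
      rw [← Complex.ofReal_one, ← Complex.ofReal_sub, Complex.norm_real, Real.norm_of_nonpos]
      <;> linarith
    have h := norm_holomorphicPart_le t (z := x) (by rw [Complex.ofReal_re]; linarith)
    rw [hnorm, Complex.ofReal_re, div_self (by linarith : 1 - x ≠ 0)] at h
    exact h.trans_eq (by ring)

/-! ### Approximation by polar parts -/

/-- On the critical line, and up to an error `ε`, the function `f` is the sum of a bounded
holomorphic function and of simple poles at the first `k` of the points `0, -1, -2, …`. -/
def HasPolarApprox (k : ℕ) (ε : ℝ) (f : ℂ → ℂ) : Prop :=
  ∃ (c : ℕ → ℂ) (b : ℂ → ℂ), IsBoundedHolomorphic b ∧ ∀ z : ℂ, z.re = 1 / 2 →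
    ‖f z - ∑ n ∈ Finset.range k, c n * (z - -(n : ℂ))⁻¹ - b z‖ ≤ ε

namespace HasPolarApprox

variable {k : ℕ} {δ ε : ℝ} {f g : ℂ → ℂ}

theorem zero : HasPolarApprox k 0 fun _ => 0 :=
  ⟨fun _ => 0, fun _ => 0, .const 0, fun z _ => by simp⟩

theorem add (hf : HasPolarApprox k δ f) (hg : HasPolarApprox k ε g) :
    HasPolarApprox k (δ + ε) fun z => f z + g z := by
  obtain ⟨c, b, hb, hfb⟩ := hf
  obtain ⟨d, b', hb', hgb⟩ := hg
  refine ⟨fun n => c n + d n, fun z => b z + b' z, hb.add hb', fun z hz => ?_⟩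
  refine (le_of_eq (congrArg norm ?_)).trans (norm_add_le_of_le (hfb z hz) (hgb z hz))
  simp only [add_mul, Finset.sum_add_distrib]
  ring

theorem sum {ι : Type*} {s : Finset ι} {f : ι → ℂ → ℂ} (hf : ∀ i ∈ s, HasPolarApprox k ε (f i)) :
    HasPolarApprox k (s.card * ε) fun z => ∑ i ∈ s, f i z := by
  classical
  induction s using Finset.induction_on with
  | empty => simpa using zero
  | insert i s hi ih =>
    have h := (hf i (s.mem_insert_self i)).add (ih fun j hj => hf j (Finset.mem_insert_of_mem hj))
    convert h using 1
    · rw [Finset.card_insert_of_notMem hi]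
      push_cast
      ring
    · simp only [Finset.sum_insert hi]

theorem mono (hf : HasPolarApprox k δ f) (h : δ ≤ ε) : HasPolarApprox k ε f := by
  obtain ⟨c, b, hb, hfb⟩ := hf
  exact ⟨c, b, hb, fun z hz => (hfb z hz).trans h⟩

theorem of_norm_sub_le (hf : HasPolarApprox k δ f) (h : ∀ z : ℂ, z.re = 1 / 2 → ‖g z - f z‖ ≤ ε) :
    HasPolarApprox k (ε + δ) g := by
  obtain ⟨c, b, hb, hfb⟩ := hf
  refine ⟨c, b, hb, fun z hz => ?_⟩
  refine (le_of_eq (congrArg norm ?_)).trans (norm_add_le_of_le (h z hz) (hfb z hz))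
  ring

theorem characteristicValue_le (h : HasPolarApprox k ε f) (hf : MemLp (onLine f) ∞ volume) :
    characteristicValue k (offDiagonal (hf.toLp _)) ≤ ε := by
  obtain ⟨c, b, hb, hfb⟩ := h
  have hre : ∀ n ∈ Finset.range k, (-(n : ℂ)).re < 1 / 2 := fun n _ => by
    rw [Complex.neg_re, Complex.natCast_re]
    linarith [n.cast_nonneg (α := ℝ)]
  simpa only [Finset.card_range] using characteristicValue_offDiagonal_le hre hb hf hfb

end HasPolarApprox

theorem hasPolarApprox_cpow_neg_mul_localRatio_archimedean {k q Q : ℕ} (hq : 0 < q) (hqQ : q ≤ Q)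
    (hk : 13 * Q ≤ k) :
    HasPolarApprox k (8 * ((2 * Real.pi * Q) ^ k / k.factorial)) fun z =>
      (q : ℂ) ^ (-z) * localRatio .archimedean z := by
  have hq' : (0 : ℝ) < q := by exact_mod_cast hq
  have hqQ' : (q : ℝ) ≤ Q := by exact_mod_cast hqQ
  have hkQ : (13 : ℝ) * Q ≤ k := by exact_mod_cast hk
  have := Real.pi_pos
  have hsmall : 2 * Real.pi * q / k.succ ≤ 1 / 2 := by
    rw [div_le_iff₀ (by positivity), Nat.cast_succ]
    nlinarith [Real.pi_lt_d2]
  refine ⟨_, holomorphicPart q, isBoundedHolomorphic_holomorphicPart hq', fun z hz =>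
    (norm_cpow_neg_mul_localRatio_archimedean_sub_le hq' hsmall hz).trans ?_⟩
  gcongr

/-! ### Dirichlet sums -/

/-- `f` is a sum of at most `Q` exponentials `q ^ (-z)`, all with `1 ≤ q ≤ Q`. -/
def IsDirichletSum (Q : ℕ) (f : ℂ → ℂ) : Prop :=
  ∃ (ι : Type) (s : Finset ι) (q : ι → ℕ), s.card ≤ Q ∧ (∀ i ∈ s, 0 < q i ∧ q i ≤ Q) ∧
    ∀ z, f z = ∑ i ∈ s, (q i : ℂ) ^ (-z)

theorem isDirichletSum_one : IsDirichletSum 1 fun _ => 1 :=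
  ⟨Unit, Finset.univ, fun _ => 1, by simp, by simp, by simp⟩

theorem IsDirichletSum.mul {Q R : ℕ} {f g : ℂ → ℂ} (hf : IsDirichletSum Q f)
    (hg : IsDirichletSum R g) : IsDirichletSum (Q * R) fun z => f z * g z := by
  obtain ⟨ι, s, q, hs, hq, hf⟩ := hf
  obtain ⟨κ, t, r, ht, hr, hg⟩ := hg
  refine ⟨ι × κ, s ×ˢ t, fun i => q i.1 * r i.2, ?_, fun i hi => ?_, fun z => ?_⟩
  · rw [Finset.card_product]
    exact Nat.mul_le_mul hs ht
  · obtain ⟨hi₁, hi₂⟩ := Finset.mem_product.1 hi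
    exact ⟨Nat.mul_pos (hq _ hi₁).1 (hr _ hi₂).1, Nat.mul_le_mul (hq _ hi₁).2 (hr _ hi₂).2⟩
  · simp only [hf, hg, Finset.sum_mul_sum, Finset.sum_product, Nat.cast_mul,
      Complex.natCast_mul_natCast_cpow]

theorem isDirichletSum_geom_sum {p : ℕ} (hp : 1 < p) (X : ℕ) :
    IsDirichletSum X fun z => ∑ n ∈ Finset.range (Nat.clog p X), ((p : ℂ) ^ (-z)) ^ n := by
  refine ⟨ℕ, Finset.range (Nat.clog p X), fun n => p ^ n, ?_, fun n hn => ⟨by positivity, ?_⟩,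
    fun z => Finset.sum_congr rfl fun n _ => ?_⟩
  · rw [Finset.card_range]
    exact (Nat.clog_le_iff_le_pow hp).2 (Nat.lt_pow_self hp).le
  · by_contra! h
    exact (Finset.mem_range.1 hn).not_ge ((Nat.clog_le_iff_le_pow hp).2 h.le)
  · rw [Nat.cast_pow, ← Complex.natCast_cpow_natCast_mul, ← Complex.cpow_nat_mul]

theorem IsDirichletSum.hasPolarApprox {k Q : ℕ} {f : ℂ → ℂ} (hf : IsDirichletSum Q f)
    (hk : 13 * Q ≤ k) :
    HasPolarApprox k (Q * (8 * ((2 * Real.pi * Q) ^ k / k.factorial))) fun z =>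
      f z * localRatio .archimedean z := by
  obtain ⟨ι, s, q, hs, hq, hf⟩ := hf
  simp only [hf, Finset.sum_mul]
  have := Real.pi_pos
  refine (HasPolarApprox.sum fun i hi => hasPolarApprox_cpow_neg_mul_localRatio_archimedean
    (hq i hi).1 (hq i hi).2 hk).mono ?_
  gcongr

/-! ### Euler products -/

theorem norm_natCast_cpow_neg_of_re_eq {n : ℕ} (hn : 0 < n) {z : ℂ} (hz : z.re = 1 / 2) :
    ‖(n : ℂ) ^ (-z)‖ = (n : ℝ) ^ (-(1 / 2) : ℝ) := by
  rw [Complex.norm_natCast_cpow_of_pos hn, Complex.neg_re, hz]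

theorem rpow_neg_half_le_three_quarters {x : ℝ} (hx : 2 ≤ x) : x ^ (-(1 / 2) : ℝ) ≤ 3 / 4 := by
  have hsqrt : 4 / 3 ≤ Real.sqrt x := Real.le_sqrt_of_sq_le (by norm_num; linarith)
  rw [Real.rpow_neg (by linarith), ← Real.sqrt_eq_rpow]
  exact (inv_anti₀ (by norm_num) hsqrt).trans_eq (by norm_num)

theorem norm_localFactor_prime_le (p : Nat.Primes) {z : ℂ} (hz : z.re = 1 / 2) :
    ‖localFactor (.prime p) z‖ ≤ 4 := by
  have hp : ‖((p : ℕ) : ℂ) ^ (-z)‖ ≤ 3 / 4 := by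
    rw [norm_natCast_cpow_neg_of_re_eq p.2.pos hz]
    exact rpow_neg_half_le_three_quarters (by exact_mod_cast p.2.two_le)
  have hsub := norm_sub_norm_le (1 : ℂ) (((p : ℕ) : ℂ) ^ (-z))
  rw [norm_one] at hsub
  rw [localFactor, norm_inv]
  exact inv_le_of_inv_le₀ (by norm_num) (by linarith)

theorem localFactor_prime_sub_geom_sum (p : Nat.Primes) {z : ℂ} (hz : 0 < z.re) (N : ℕ) :
    localFactor (.prime p) z - ∑ n ∈ Finset.range N, (((p : ℕ) : ℂ) ^ (-z)) ^ n =
      (((p : ℕ) : ℂ) ^ (-z)) ^ N * localFactor (.prime p) z := by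
  have hne := inv_ne_zero (localFactor_ne_zero (.prime p) hz)
  rw [localFactor, inv_inv] at hne
  have hsum := mul_neg_geom_sum (((p : ℕ) : ℂ) ^ (-z)) N
  rw [localFactor]
  field_simp
  rw [hsum]
  ring

theorem rpow_neg_pow_clog_le {p X : ℕ} (hp : 1 < p) (hX : 0 < X) {β : ℝ} (hβ : 0 ≤ β) :
    ((p : ℝ) ^ (-β)) ^ Nat.clog p X ≤ (X : ℝ) ^ (-β) := by
  rw [Real.rpow_pow_comm p.cast_nonneg]
  exact Real.rpow_le_rpow_of_nonpos (by exact_mod_cast hX)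
    (by exact_mod_cast Nat.le_pow_clog hp X) (neg_nonpos.2 hβ)

theorem norm_localFactor_prime_sub_geom_sum_le (p : Nat.Primes) {X : ℕ} (hX : 0 < X) {z : ℂ}
    (hz : z.re = 1 / 2) :
    ‖localFactor (.prime p) z -
      ∑ n ∈ Finset.range (Nat.clog p X), (((p : ℕ) : ℂ) ^ (-z)) ^ n‖ ≤
      4 * (X : ℝ) ^ (-(1 / 2) : ℝ) := by
  rw [localFactor_prime_sub_geom_sum p (by rw [hz]; norm_num), norm_mul, norm_pow,
    norm_natCast_cpow_neg_of_re_eq p.2.pos hz, mul_comm]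
  exact mul_le_mul (norm_localFactor_prime_le p hz)
    (rpow_neg_pow_clog_le p.2.one_lt hX (by norm_num)) (by positivity) (by norm_num)

/-- The partial Euler product `∏ γ_p` over the primes of `S`. -/
noncomputable def eulerProduct (S : Finset Nat.Primes) (z : ℂ) : ℂ :=
  ∏ p ∈ S, localFactor (.prime p) z

theorem norm_eulerProduct_le (S : Finset Nat.Primes) {z : ℂ} (hz : z.re = 1 / 2) :
    ‖eulerProduct S z‖ ≤ 4 ^ S.card := by
  rw [eulerProduct, norm_prod, ← Finset.prod_const]
  exact Finset.prod_le_prod (fun _ _ => norm_nonneg _) fun p _ => norm_localFactor_prime_le p hz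

theorem continuousOn_eulerProduct (S : Finset Nat.Primes) :
    ContinuousOn (eulerProduct S) {z : ℂ | z.re = 1 / 2} :=
  continuousOn_finsetProd S fun p _ => continuousOn_localFactor (.prime p)

theorem exists_isDirichletSum_norm_eulerProduct_sub_le (S : Finset Nat.Primes) :
    ∃ C : ℝ, ∀ X : ℕ, 0 < X → ∃ D, IsDirichletSum (X ^ S.card) D ∧ ∀ z : ℂ, z.re = 1 / 2 →
      ‖eulerProduct S z - D z‖ ≤ C * (X : ℝ) ^ (-(1 / 2) : ℝ) := by
  classical
  induction S using Finset.induction_on with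
  | empty => exact ⟨0, fun X _ => ⟨_, by simpa using isDirichletSum_one, by simp [eulerProduct]⟩⟩
  | insert p S hp ih =>
    obtain ⟨C, hC⟩ := ih
    refine ⟨4 * 4 ^ S.card + 8 * C, fun X hX => ?_⟩
    obtain ⟨D, hD, hSD⟩ := hC X hX
    refine ⟨_, by
      simpa only [Finset.card_insert_of_notMem hp, pow_succ'] using
        (isDirichletSum_geom_sum p.2.one_lt X).mul hD, fun z hz => ?_⟩
    set ε : ℝ := (X : ℝ) ^ (-(1 / 2) : ℝ)
    set G := ∑ n ∈ Finset.range (Nat.clog p X), (((p : ℕ) : ℂ) ^ (-z)) ^ n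
    have hpG : ‖localFactor (.prime p) z - G‖ ≤ 4 * ε :=
      norm_localFactor_prime_sub_geom_sum_le p hX hz
    have hε : ε ≤ 1 := Real.rpow_le_one_of_one_le_of_nonpos (by exact_mod_cast hX) (by norm_num)
    have hG : ‖G‖ ≤ 8 := by
      linarith [norm_le_norm_add_norm_sub (localFactor (.prime p) z) G,
        norm_localFactor_prime_le p hz]
    calc ‖eulerProduct (insert p S) z - G * D z‖
        = ‖(localFactor (.prime p) z - G) * eulerProduct S z +
            G * (eulerProduct S z - D z)‖ := by
          rw [eulerProduct, Finset.prod_insert hp, ← eulerProduct]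
          ring_nf
      _ ≤ ‖localFactor (.prime p) z - G‖ * ‖eulerProduct S z‖ +
            ‖G‖ * ‖eulerProduct S z - D z‖ :=
          (norm_add_le _ _).trans_eq (by rw [norm_mul, norm_mul])
      _ ≤ 4 * ε * 4 ^ S.card + 8 * (C * ε) :=
          add_le_add (mul_le_mul hpG (norm_eulerProduct_le S hz) (norm_nonneg _) (by positivity))
            (mul_le_mul hG (hSD z hz) (norm_nonneg _) (by norm_num))
      _ = (4 * 4 ^ S.card + 8 * C) * ε := by ring

/-- The bounded holomorphic factor `∏ γ_p(1 - z)⁻¹` of the product of the `ρ_p` over the primes of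
`S`. -/
noncomputable def dualEulerProduct (S : Finset Nat.Primes) (z : ℂ) : ℂ :=
  ∏ p ∈ S, (localFactor (.prime p) (1 - z))⁻¹

theorem isBoundedHolomorphic_dualEulerProduct (S : Finset Nat.Primes) :
    IsBoundedHolomorphic (dualEulerProduct S) := by
  refine .prod fun p _ => ⟨((differentiable_inv_localFactor (.prime p)).comp
    (differentiable_id.const_sub 1)).diffContOnCl, 1 + 1, fun z hz => ?_⟩
  rw [localFactor, inv_inv]
  refine norm_sub_le_of_le norm_one.le (norm_natCast_cpow_neg_lt_one p.2.one_lt ?_).le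
  rw [Complex.sub_re, Complex.one_re]
  linarith

/-! ### Rates of decay -/

theorem pow_div_factorial_le_exp_sub {x : ℝ} (hx : 0 ≤ x) (n : ℕ) :
    x ^ n / n.factorial ≤ Real.exp (Real.exp 1 * x - n) := by
  have h := Real.pow_div_factorial_le_exp _ (mul_nonneg (Real.exp_pos 1).le hx) n
  rw [mul_pow, Real.exp_one_pow, mul_div_assoc] at h
  rwa [Real.exp_sub, le_div_iff₀' (Real.exp_pos _)]

theorem isBigO_exp_neg_rpow_neg (α : ℝ) :
    (fun n : ℕ => Real.exp (-n)) =O[atTop] fun n : ℕ => (n : ℝ) ^ (-α) := by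
  simpa [Function.comp_def] using
    (isLittleO_exp_neg_mul_rpow_atTop one_pos (-α)).isBigO.comp_tendsto tendsto_natCast_atTop_atTop

theorem isBigO_rpow_neg_div_of_le {f : ℕ → ℝ} (hf : Antitone f) (hf0 : ∀ n, 0 ≤ f n) {A m : ℕ}
    (hA : 0 < A) (hm : 0 < m) {β C : ℝ} (hβ : 0 ≤ β)
    (h : ∀ X : ℕ, 0 < X → f (A * X ^ m) ≤ C * (X : ℝ) ^ (-β)) :
    f =O[atTop] fun n : ℕ => (n : ℝ) ^ (-(β / m)) := by
  have hA' : (0 : ℝ) < A := by exact_mod_cast hA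
  have : (0 : ℝ) < m := by exact_mod_cast hm
  have hC : 0 ≤ C := by simpa using (hf0 _).trans (h 1 one_pos)
  refine Asymptotics.IsBigO.of_bound (C * (2 ^ β * (A : ℝ) ^ (β / m))) ?_
  filter_upwards [eventually_ge_atTop A] with n hn
  have hn' : (A : ℝ) ≤ n := by exact_mod_cast hn
  set t : ℝ := (n / A : ℝ) ^ ((m : ℝ)⁻¹) with ht
  have ht1 : 1 ≤ t := Real.one_le_rpow ((one_le_div hA').2 hn') (by positivity)
  have hX : 0 < ⌊t⌋₊ := Nat.floor_pos.2 ht1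
  have hroot : A * ⌊t⌋₊ ^ m ≤ n := by
    have hpow : (⌊t⌋₊ : ℝ) ^ m ≤ n / A := by
      refine (pow_le_pow_left₀ (Nat.cast_nonneg _) (Nat.floor_le (by linarith)) m).trans_eq ?_
      rw [ht, Real.rpow_inv_natCast_pow (by positivity) hm.ne']
    rw [le_div_iff₀' hA'] at hpow
    exact_mod_cast hpow
  have hhalf : t / 2 ≤ ⌊t⌋₊ := by
    have : (1 : ℝ) ≤ ⌊t⌋₊ := by exact_mod_cast hX
    linarith [Nat.lt_floor_add_one t]
  rw [Real.norm_of_nonneg (hf0 n), Real.norm_of_nonneg (by positivity)]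
  calc f n ≤ C * (⌊t⌋₊ : ℝ) ^ (-β) := (hf hroot).trans (h _ hX)
    _ ≤ C * (t / 2) ^ (-β) := mul_le_mul_of_nonneg_left
        (Real.rpow_le_rpow_of_nonpos (by linarith) hhalf (neg_nonpos.2 hβ)) hC
    _ = C * (2 ^ β * (A : ℝ) ^ (β / m)) * (n : ℝ) ^ (-(β / m)) := by
      rw [Real.div_rpow (by linarith) two_pos.le, ht, ← Real.rpow_mul (by positivity),
        Real.div_rpow n.cast_nonneg A.cast_nonneg, inv_mul_eq_div, neg_div,
        Real.rpow_neg two_pos.le, Real.rpow_neg A.cast_nonneg]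
      field_simp

theorem mul_pow_div_factorial_le_inv {Q : ℕ} (hQ : 0 < Q) :
    Q * (8 * ((2 * Real.pi * Q) ^ (20 * Q) / (20 * Q).factorial)) ≤ 8 * (Q : ℝ)⁻¹ := by
  have hQ' : (0 : ℝ) < Q := by exact_mod_cast hQ
  have hpi := Real.pi_pos
  have hexp : Real.exp 1 * (2 * Real.pi * Q) - (20 * Q : ℕ) ≤ -Q + -Q := by
    have : Real.exp 1 * Real.pi ≤ 2.75 * 3.15 :=
      mul_le_mul (by linarith [Real.exp_one_lt_d9]) Real.pi_lt_d2.le hpi.le (by norm_num)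
    push_cast
    nlinarith
  have hinv : Real.exp (-Q) ≤ (Q : ℝ)⁻¹ := by
    rw [Real.exp_neg]
    exact inv_anti₀ hQ' (by linarith [Real.add_one_le_exp (Q : ℝ)])
  have hfact := (pow_div_factorial_le_exp_sub (x := 2 * Real.pi * Q) (by positivity)
    (20 * Q)).trans (Real.exp_le_exp.2 hexp)
  rw [Real.exp_add] at hfact
  calc (Q : ℝ) * (8 * ((2 * Real.pi * Q) ^ (20 * Q) / (20 * Q).factorial))
      ≤ Q * (8 * ((Q : ℝ)⁻¹ * (Q : ℝ)⁻¹)) := by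
        gcongr
        exact hfact.trans (mul_le_mul hinv hinv (Real.exp_pos _).le (by positivity))
    _ = 8 * (Q : ℝ)⁻¹ := by field_simp

/-! ### The product of the ratios -/

theorem hasPolarApprox_eulerProduct_mul_localRatio_archimedean {S : Finset Nat.Primes}
    (hS : S.Nonempty) :
    ∃ C : ℝ, ∀ X : ℕ, 0 < X → HasPolarApprox (20 * X ^ S.card) (C * (X : ℝ) ^ (-(1 / 2) : ℝ))
      fun z => eulerProduct S z * localRatio .archimedean z := by
  obtain ⟨C, hC⟩ := exists_isDirichletSum_norm_eulerProduct_sub_le S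
  refine ⟨C + 8, fun X hX => ?_⟩
  obtain ⟨D, hD, hSD⟩ := hC X hX
  have hX' : (1 : ℝ) ≤ X := by exact_mod_cast hX
  have hinv : (((X ^ S.card : ℕ) : ℝ))⁻¹ ≤ (X : ℝ) ^ (-(1 / 2) : ℝ) := by
    push_cast
    rw [← Real.rpow_natCast, ← Real.rpow_neg X.cast_nonneg]
    have : (1 : ℝ) ≤ S.card := by exact_mod_cast hS.card_pos
    exact Real.rpow_le_rpow_of_exponent_le hX' (by linarith)
  refine ((hD.hasPolarApprox (Nat.mul_le_mul_right _ (by norm_num))).of_norm_sub_le fun z hz =>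
    ?_).mono ((add_le_add_right ((mul_pow_div_factorial_le_inv (by positivity)).trans
      (mul_le_mul_of_nonneg_left hinv (by norm_num))) _).trans_eq (add_mul _ _ _).symm)
  rw [← sub_mul, norm_mul, norm_localRatio _ hz, mul_one]
  exact hSD z hz

theorem memLp_top_eulerProduct_mul_localRatio_archimedean (S : Finset Nat.Primes) :
    MemLp (onLine fun z => eulerProduct S z * localRatio .archimedean z) ∞ volume := by
  refine memLp_top_onLine (C := 4 ^ S.card)
    ((continuousOn_eulerProduct S).mul (continuousOn_localRatio _)) fun z hz => ?_
  rw [norm_mul, norm_localRatio _ hz, mul_one]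
  exact norm_eulerProduct_le S hz

theorem isInfinitesimalOfOrder_eulerProduct {S : Finset Nat.Primes} (hS : S.Nonempty) :
    IsInfinitesimalOfOrder (1 / (2 * (S.card : ℝ)))
      (offDiagonal ((memLp_top_eulerProduct_mul_localRatio_archimedean S).toLp _)) := by
  have hcard := hS.card_pos
  obtain ⟨C, hC⟩ := hasPolarApprox_eulerProduct_mul_localRatio_archimedean hS
  rw [← div_div]
  exact isInfinitesimalOfOrder_of_isBigO (by positivity)
    (isBigO_rpow_neg_div_of_le (characteristicValue_antitone _)
      (fun n => characteristicValue_nonneg n _) (by norm_num) hcard (by norm_num)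
      fun X hX => (hC X hX).characteristicValue_le _)

theorem isInfinitesimalOfOrder_eulerProduct_empty {α : ℝ} (hα : 0 < α) :
    IsInfinitesimalOfOrder α
      (offDiagonal ((memLp_top_eulerProduct_mul_localRatio_archimedean ∅).toLp _)) := by
  refine isInfinitesimalOfOrder_of_isBigO hα
    ((Asymptotics.IsBigO.of_bound (8 * Real.exp (Real.exp 1 * (2 * Real.pi))) ?_).trans
      (isBigO_exp_neg_rpow_neg α))
  filter_upwards [eventually_ge_atTop 13] with n hn
  have happrox : HasPolarApprox n (8 * ((2 * Real.pi) ^ n / n.factorial))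
      fun z => eulerProduct ∅ z * localRatio .archimedean z := by
    simpa [eulerProduct] using isDirichletSum_one.hasPolarApprox (k := n) (by simpa using hn)
  rw [Real.norm_of_nonneg (characteristicValue_nonneg n _),
    Real.norm_of_nonneg (Real.exp_pos _).le, mul_assoc, ← Real.exp_add, ← sub_eq_add_neg]
  exact (happrox.characteristicValue_le _).trans (mul_le_mul_of_nonneg_left
    (pow_div_factorial_le_exp_sub Real.two_pi_pos.le n) (by norm_num))

theorem norm_ratioProduct (F : Finset Place) {z : ℂ} (hz : z.re = 1 / 2) :
    ‖ratioProduct F z‖ = 1 := by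
  rw [ratioProduct, norm_prod]
  exact Finset.prod_eq_one fun v _ => norm_localRatio v hz

theorem memLp_top_ratioProduct (F : Finset Place) : MemLp (onLine (ratioProduct F)) ∞ volume :=
  memLp_top_onLine (continuousOn_finsetProd F fun v _ => continuousOn_localRatio v)
    fun _ hz => (norm_ratioProduct F hz).le

theorem Place.prime_injective : Function.Injective Place.prime := fun p q h => by
  injection h

theorem exists_ratioProduct_eq {F : Finset Place} (hF : .archimedean ∈ F) :
    ∃ S : Finset Nat.Primes, F.card = S.card + 1 ∧ ratioProduct F = fun z =>
      eulerProduct S z * localRatio .archimedean z * dualEulerProduct S z := by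
  classical
  set S : Finset Nat.Primes := F.preimage Place.prime Place.prime_injective.injOn
  have hS : F.erase .archimedean = S.map ⟨Place.prime, Place.prime_injective⟩ := by
    ext v
    cases v with
    | archimedean => simp
    | prime p => simp [S]
  refine ⟨S, ?_, funext fun z => ?_⟩
  · rw [← Finset.card_erase_add_one hF, hS, Finset.card_map]
  · rw [ratioProduct, ← Finset.mul_prod_erase F _ hF, hS, Finset.prod_map, mul_right_comm,
      mul_comm, eulerProduct, dualEulerProduct, ← Finset.prod_mul_distrib]
    rfl

theorem isInfinitesimalOfOrder_offDiagonal_mul {f g b : ℂ → ℂ} {α : ℝ}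
    {hf : MemLp (onLine f) ∞ volume} (h : IsInfinitesimalOfOrder α (offDiagonal (hf.toLp _)))
    (hb : IsBoundedHolomorphic b) (hg : MemLp (onLine g) ∞ volume)
    (hfb : g = fun z => f z * b z) : IsInfinitesimalOfOrder α (offDiagonal (hg.toLp _)) := by
  subst hfb
  rw [offDiagonal_mul hf hb hg]
  exact h.comp _

end QuasiInner

open QuasiInner in
theorem mainTheorem1 (F : Finset QuasiInner.Place) (hF : QuasiInner.Place.archimedean ∈ F)
    (m : ℕ) (hm : F.card = m + 1) :
    ∃ hu : MemLp (fun s : ℝ => QuasiInner.ratioProduct F (QuasiInner.linePoint (1 / 2) s)) ∞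
        (volume : Measure ℝ),
      QuasiInner.IsQuasiInner (hu.toLp _) ∧
      (0 < m → QuasiInner.IsInfinitesimalOfOrder (1 / (2 * (m : ℝ)))
        (QuasiInner.offDiagonal (hu.toLp _))) ∧
      (m = 0 → ∀ α : ℝ, 0 < α → QuasiInner.IsInfinitesimalOfOrder α
        (QuasiInner.offDiagonal (hu.toLp _))) := by
  obtain ⟨S, hS, hprod⟩ := exists_ratioProduct_eq hF
  obtain rfl : m = S.card := by omega
  have hu := memLp_top_ratioProduct F
  have hdual := isBoundedHolomorphic_dualEulerProduct S
  have hpos (h : 0 < S.card) :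
      IsInfinitesimalOfOrder (1 / (2 * (S.card : ℝ))) (offDiagonal (hu.toLp _)) :=
    isInfinitesimalOfOrder_offDiagonal_mul
      (isInfinitesimalOfOrder_eulerProduct (Finset.card_pos.1 h)) hdual hu hprod
  have hzero (h : S.card = 0) (α : ℝ) (hα : 0 < α) :
      IsInfinitesimalOfOrder α (offDiagonal (hu.toLp _)) := by
    obtain rfl := Finset.card_eq_zero.1 h
    exact isInfinitesimalOfOrder_offDiagonal_mul (isInfinitesimalOfOrder_eulerProduct_empty hα)
      hdual hu hprod
  refine ⟨hu, ⟨?_, ?_⟩, hpos, hzero⟩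
  · filter_upwards [hu.coeFn_toLp] with s hs
    rw [hs, norm_ratioProduct F (re_linePoint _ s)]
  · rcases Nat.eq_zero_or_pos S.card with h | h
    · exact (hzero h 1 one_pos).1
    · exact (hpos h).1
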